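/- **Theorem 3.1.** *Notation.* For $\mathbf s=(s_1,\dots,s_r)\in\mathbb N^r$ (positive integers) and $\boldsymbol\mu=(\mu_1,\dots,\mu_r)\in\{\pm1\}^r$ put $$\zeta^{(M)}(\mathbf s;\boldsymbol\mu)=\sum_{M\ge n_1>\cdots>n_r>0}\frac{\mu_1^{n_1}\cdots\mu_r^{n_r}}{n_1^{s_1}\cdots n_r^{s_r}},\qquad I^{(\varepsilon)}(\mathbf s;\boldsymbol\mu)=\int_0^{1-\varepsilon}\Big(\frac{dt}{t}\Big)^{s_1-1}\frac{dt}{a_1-t}\cdots\Big(\frac{dt}{t}\Big)^{s_r-1}\frac{dt}{a_r-t}$$ (an iterated integral over $1-\varepsilon>t_1>t_2>\cdots>0$, with $a_i=\mu_1\cdots\mu_i$), and $\zeta(\mathbf s;\boldsymbol\mu)=\lim_{M\to\infty}\zeta^{(M)}(\mathbf s;\boldsymbol\mu)$ if $(s_1,\mu_1)\neq(1,1)$. The regularized Euler sums $\zeta_*(\mathbf s;\boldsymbol\mu),\zeta_{\mathrm{sh}}(\mathbf s;\boldsymbol\mu)\in\mathbb R[T]$ are the unique polynomials $P_*,P_{\mathrm{sh}}$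 with $\zeta^{(M)}(\mathbf s;\boldsymbol\mu)-P_*(\log M+\gamma)\to0$ as $M\to\infty$ ($\gamma$ is Euler's constant) and $I^{(\varepsilon)}(\mathbf s;\boldsymbol\mu)-P_{\mathrm{sh}}(-\log\varepsilon)\to0$ as $\varepsilon\to0^+$. Write $1_n$ for $1$ repeated $n$ times. *Statement.* Let $u\ge3$, $d\ge0$, $q=u-1$ and $\boldsymbol\mu=(\mu_1,\dots,\mu_{d+2})\in\{\pm1\}^{d+2}$. Put $\nu_2=\mu_1\mu_2$ and $\nu_j=\mu_j$ for $j\ne2$. Then all the Euler sums and regularized Euler sums below exist, and in $\mathbb R[T]$ $$\sum_{\substack{a+b=u\\ a,b\ge1}}\zeta_{\mathrm{sh}}(a,b,1_d;\boldsymbol\mu)=\mathrm{I}+\mathrm{II}-\mathrm{III},$$ where $$\mathrm I=\zeta_*(1,q,1_d;\nu_1,\nu_2,\dots,\nu_{d+2})+\sum_{j=0}^{d}\zeta(q,1_{d+1};\nu_2,\dots,\nu_{j+2},\nu_1,\nu_{j+3},\dots,\nu_{d+2}),$$ $$\mathrm{II}=\zeta(u,1_d;\nu_1\nu_2,\nu_3,\dots,\nu_{d+2})+\sum_{j=0}^{d-1}\zeta(q,1_j,2,1_{d-1-j};\nu_2,\dots,\nu_{j+2},\nu_1\nu_{j+3},\nu_{j+4},\dots,\nu_{d+2}),$$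 $$\mathrm{III}=\sum_{j=0}^{d}\zeta(q,1_{d+1};\nu_2,\dots,\nu_{j+2},\nu_1\cdots\nu_{j+2},\nu_1\cdots\nu_{j+3},\nu_{j+4},\dots,\nu_{d+2}),$$ and in the summand $j=d$ of $\mathrm{III}$ the sign list is $\nu_2,\dots,\nu_{d+2},\nu_1\cdots\nu_{d+2}$ (the entry $\nu_1\cdots\nu_{d+3}$ is absent). In particular, if $\mu_1=1$ and $\boldsymbol\mu_2=(\mu_2,\dots,\mu_{d+2})$, then $$\sum_{\substack{a+b=u\\ a\ge2,\,b\ge1}}\zeta(a,b,1_d;1,\boldsymbol\mu_2)=\zeta(u,1_d;\boldsymbol\mu_2)+\sum_{j=0}^{d}\zeta(q,1_{d+1};\mu_2,\dots,\mu_{j+2},\mu_1,\mu_{j+3},\dots,\mu_{d+2})+\sum_{j=0}^{d-1}\zeta(q,1_j,2,1_{d-1-j};\boldsymbol\mu_2)-\sum_{j=0}^{d}\zeta(q,1_{d+1};\mu_2,\dots,\mu_{j+2},\mu_2\cdots\mu_{j+2},\mu_2\cdots\mu_{j+3},\mu_{j+4},\dots,\mu_{d+2}),$$ where again in the last sum the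 entry $\mu_2\cdots\mu_{d+3}$ of the summand $j=d$ is absent. -/

import Mathlib

open Filter Topology Polynomial

/-- The truncated Euler sum
`ζ^(M)(s; μ) = ∑_{M ≥ n₁ > ⋯ > n_r > 0} μ₁^{n₁} ⋯ μ_r^{n_r} / (n₁^{s₁} ⋯ n_r^{s_r})`,
for a list `s` of exponents and a list `μ` of signs of the same length
(the sum is organised by its largest index `n₁`; the empty sum of depth `0` is `1`). -/
noncomputable def truncEulerSum : List ℕ → List ℤˣ → ℕ → ℝ
  | s₁ :: s, μ₁ :: μ, M =>
      ∑ n ∈ Finset.Icc 1 M, (((μ₁ : ℤ) : ℝ) ^ n / (n : ℝ) ^ s₁) * truncEulerSum s μ (n - 1)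
  | _, _, _ => 1

/-- The Euler sum `ζ(s; μ) = lim_{M → ∞} ζ^(M)(s; μ)`
(meaningful for admissible `(s; μ)`, i.e. `(s₁, μ₁) ≠ (1, 1)`). -/
noncomputable def eulerSum (s : List ℕ) (μ : List ℤˣ) : ℝ :=
  limUnder atTop (truncEulerSum s μ)

/-- The iterated integral `∫_{z > t₁ > t₂ > ⋯ > 0} f₁(t₁) dt₁ f₂(t₂) dt₂ ⋯`. -/
noncomputable def iteratedIntegral : List (ℝ → ℝ) → ℝ → ℝ
  | [], _ => 1
  | f :: fs, z => ∫ t in (0 : ℝ)..z, f t * iteratedIntegral fs t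

/-- The densities of the forms
`(dt/t)^{s₁-1} dt/(a₁-t) ⋯ (dt/t)^{s_r-1} dt/(a_r-t)` with `a_i = a μ₁ ⋯ μ_i`
(signs are their own inverses, so `∏ μ_j⁻¹ = ∏ μ_j`). -/
noncomputable def eulerForms : ℤˣ → List ℕ → List ℤˣ → List (ℝ → ℝ)
  | a, s₁ :: s, μ₁ :: μ =>
      List.replicate (s₁ - 1) (fun t : ℝ => 1 / t) ++
        (fun t : ℝ => 1 / ((((a * μ₁ : ℤˣ) : ℤ) : ℝ) - t)) :: eulerForms (a * μ₁) s μ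
  | _, _, _ => []

/-- `I^(ε)(s; μ) = ∫_0^{1-ε} (dt/t)^{s₁-1} dt/(a₁-t) ⋯ (dt/t)^{s_r-1} dt/(a_r-t)`,
`a_i = μ₁ ⋯ μ_i`. -/
noncomputable def truncEulerIntegral (s : List ℕ) (μ : List ℤˣ) (ε : ℝ) : ℝ :=
  iteratedIntegral (eulerForms 1 s μ) (1 - ε)

/-- `P ∈ ℝ[T]` is the `*`-regularization of `(s; μ)`: the asymptotic expansion of `ζ^(M)(s; μ)`
in powers of `T = log M + γ` as `M → ∞` (normalised so that `ζ_*(1; 1) = T`). -/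
def IsStarReg (s : List ℕ) (μ : List ℤˣ) (P : ℝ[X]) : Prop :=
  Tendsto (fun M : ℕ =>
      truncEulerSum s μ M - P.eval (Real.log M + Real.eulerMascheroniConstant))
    atTop (𝓝 0)

/-- `P ∈ ℝ[T]` is the `ш`-regularization of `(s; μ)`: the asymptotic expansion of `I^(ε)(s; μ)`
in powers of `T = -log ε` as `ε → 0⁺` (normalised so that `ζ_ш(1; 1) = T`). -/
def IsShuffleReg (s : List ℕ) (μ : List ℤˣ) (P : ℝ[X]) : Prop :=
  Tendsto (fun ε : ℝ => truncEulerIntegral s μ ε - P.eval (-Real.log ε)) (𝓝[>] 0) (𝓝 0)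

/-- A polynomial that tends to zero along a quantity tending to infinity is zero. -/
theorem polynomial_eq_zero_of_tendsto {α : Type*} {l : Filter α} [l.NeBot] {g : α → ℝ}
    (hg : Tendsto g l atTop) {P : ℝ[X]} (h : Tendsto (fun x => P.eval (g x)) l (𝓝 0)) :
    P = 0 := by
  by_contra hP
  rcases lt_or_ge 0 P.degree with hd | hd
  · have h1 := (P.abs_tendsto_atTop hd).comp hg
    have h2 := h.abs
    exact not_tendsto_nhds_of_tendsto_atTop h1 _ h2
  · rw [Polynomial.eq_C_of_degree_le_zero hd] at h hP
    simp only [eval_C] at h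
    exact hP (by rw [tendsto_nhds_unique tendsto_const_nhds h, C_0])

theorem IsStarReg.unique {s : List ℕ} {μ : List ℤˣ} {P Q : ℝ[X]}
    (hP : IsStarReg s μ P) (hQ : IsStarReg s μ Q) : P = Q := by
  have hg : Tendsto (fun M : ℕ => Real.log M + Real.eulerMascheroniConstant) atTop atTop :=
    tendsto_atTop_add_const_right _ _ (Real.tendsto_log_atTop.comp tendsto_natCast_atTop_atTop)
  refine sub_eq_zero.1 (polynomial_eq_zero_of_tendsto hg ?_)
  have h := Tendsto.sub hQ hP
  rw [sub_zero] at h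
  refine h.congr fun M => ?_
  rw [eval_sub]
  ring

theorem IsShuffleReg.unique {s : List ℕ} {μ : List ℤˣ} {P Q : ℝ[X]}
    (hP : IsShuffleReg s μ P) (hQ : IsShuffleReg s μ Q) : P = Q := by
  have hg : Tendsto (fun ε : ℝ => -Real.log ε) (𝓝[>] 0) atTop :=
    tendsto_neg_atBot_atTop.comp Real.tendsto_log_nhdsGT_zero
  refine sub_eq_zero.1 (polynomial_eq_zero_of_tendsto hg ?_)
  have h := Tendsto.sub hQ hP
  rw [sub_zero] at h
  refine h.congr fun M => ?_
  rw [eval_sub]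
  ring

/-- The `*`-regularized Euler sum `ζ_*(s; μ) ∈ ℝ[T]`: the unique `*`-regularization. -/
noncomputable def starReg (s : List ℕ) (μ : List ℤˣ) : ℝ[X] :=
  Classical.epsilon (IsStarReg s μ)

/-- The `ш`-regularized Euler sum `ζ_ш(s; μ) ∈ ℝ[T]`: the unique `ш`-regularization. -/
noncomputable def shuffleReg (s : List ℕ) (μ : List ℤˣ) : ℝ[X] :=
  Classical.epsilon (IsShuffleReg s μ)

/-- `1_n = (1, …, 1)` with `n` entries. -/
def ones (n : ℕ) : List ℕ := List.replicate n 1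

/-- The list `(ν_i, ν_{i+1}, …, ν_k)`; it is empty if `k < i`. -/
def seg (ν : ℕ → ℤˣ) (i k : ℕ) : List ℤˣ := (List.range' i (k + 1 - i)).map ν

/-- The signs `ν₂ = μ₁ μ₂` and `ν_j = μ_j` for `j ≠ 2`. -/
def nuSigns (μ : ℕ → ℤˣ) (j : ℕ) : ℤˣ := if j = 2 then μ 1 * μ 2 else μ j

/-- `I = ζ_*(1, q, 1_d; ν₁, …, ν_{d+2})
  + ∑_{j=0}^{d} ζ(q, 1_{d+1}; ν₂, …, ν_{j+2}, ν₁, ν_{j+3}, …, ν_{d+2})`. -/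
noncomputable def sumI (q d : ℕ) (ν : ℕ → ℤˣ) : ℝ[X] :=
  starReg (1 :: q :: ones d) (seg ν 1 (d + 2)) +
    ∑ j ∈ Finset.range (d + 1),
      C (eulerSum (q :: ones (d + 1)) (seg ν 2 (j + 2) ++ [ν 1] ++ seg ν (j + 3) (d + 2)))

/-- `II = ζ(u, 1_d; ν₁ν₂, ν₃, …, ν_{d+2})
  + ∑_{j=0}^{d-1} ζ(q, 1_j, 2, 1_{d-1-j}; ν₂, …, ν_{j+2}, ν₁ν_{j+3}, ν_{j+4}, …, ν_{d+2})`. -/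
noncomputable def sumII (u q d : ℕ) (ν : ℕ → ℤˣ) : ℝ :=
  eulerSum (u :: ones d) ([ν 1 * ν 2] ++ seg ν 3 (d + 2)) +
    ∑ j ∈ Finset.range d,
      eulerSum (q :: (ones j ++ [2] ++ ones (d - 1 - j)))
        (seg ν 2 (j + 2) ++ [ν 1 * ν (j + 3)] ++ seg ν (j + 4) (d + 2))

/-- `III = ∑_{j=0}^{d}
  ζ(q, 1_{d+1}; ν₂, …, ν_{j+2}, ν₁ ⋯ ν_{j+2}, ν₁ ⋯ ν_{j+3}, ν_{j+4}, …, ν_{d+2})`,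
where in the summand `j = d` (written last) the sign `ν₁ ⋯ ν_{d+3}` is absent. -/
noncomputable def sumIII (q d : ℕ) (ν : ℕ → ℤˣ) : ℝ :=
  ∑ j ∈ Finset.range d,
      eulerSum (q :: ones (d + 1))
        (seg ν 2 (j + 2) ++ [∏ i ∈ Finset.Icc 1 (j + 2), ν i, ∏ i ∈ Finset.Icc 1 (j + 3), ν i] ++
          seg ν (j + 4) (d + 2)) +
    eulerSum (q :: ones (d + 1)) (seg ν 2 (d + 2) ++ [∏ i ∈ Finset.Icc 1 (d + 2), ν i])

/-! The identity is a regularized double shuffle relation: the product of the depth one sum with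
sign ν₁ and the sum of (q, 1_d) with signs ν₂, …, ν_{d+2} is expanded in two ways.

Truncated sums multiply by the stuffle rule (`truncEulerSum_singleton_mul`): the new index is
inserted, which gives I, or merged with an old one, which gives II. Truncated integrals multiply by
the shuffle rule (`wordIntegral_singleton_mul`): the letter dt/(ν₁-t) is inserted into the word of
(q, 1_d). Inside the leading block of dt/t it yields the sums over a + b = u, the twist ν₂ = μ₁μ₂
being what makes the poles match; behind that block it yields III.

The two truncations are unrelated in general, so both must give the product the same polynomial in
T. They do because q ≥ 2: the second factor converges at a polynomial rate to some c, which beats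
the logarithmic growth of the first factor, and the product is c(αT + β) + o(1) in both cases
(`exists_reg_one_mul`). The same rate shows that the two regularizations of (1, q, 1_d) exist and
agree (`exists_isStarReg_isShuffleReg`).

Sums and integrals are linked by Taylor expansion: the coefficients of the iterated integral are the
terms of the Euler sum (`wordIntegral_eq_tsum`, `wordCoeff_eulerWord`), so the truncated integral is
an Abel sum of the same series. A polynomial in T is determined by its asymptotics, which turns the
two expansions into an identity in ℝ[T]. -/

/-! ### Rates of convergence for partial sums and Abel sums -/

/-- A polynomially weighted absolutely convergent series converges at a polynomial rate. -/
theorem abs_tsum_sub_sum_range_mul_rpow_le {b : ℕ → ℝ} {δ : ℝ} (hδ : 0 < δ)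
    (hb : Summable fun n => |b n| * (n : ℝ) ^ δ) (hs : Summable b) (N : ℕ) :
    |∑' n, b n - ∑ n ∈ Finset.range N, b n| * (N : ℝ) ^ δ ≤ ∑' n, |b n| * (n : ℝ) ^ δ := by
  have h1 : ∑' n, b n - ∑ n ∈ Finset.range N, b n = ∑' n, b (n + N) := by
    rw [← hs.sum_add_tsum_nat_add N]; ring
  have hN : 0 ≤ (N : ℝ) ^ δ := by positivity
  have hb' := (summable_nat_add_iff N).2 hb
  rw [h1, ← abs_of_nonneg hN, ← abs_mul, ← tsum_mul_right, ← Real.norm_eq_abs]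
  refine (tsum_of_norm_bounded hb'.hasSum fun n => ?_).trans ?_
  · rw [Real.norm_eq_abs, abs_mul, abs_of_nonneg hN]
    refine mul_le_mul_of_nonneg_left ?_ (abs_nonneg _)
    exact Real.rpow_le_rpow (by positivity) (by push_cast; linarith [n.cast_nonneg (α := ℝ)]) hδ.le
  · rw [← hb.sum_add_tsum_nat_add N]
    exact le_add_of_nonneg_left (Finset.sum_nonneg fun i _ => by positivity)

/-- Put x = n(1 - z). If x ≤ 1, Bernoulli bounds the left side by x, and x ≤ x^δ; if x ≥ 1, the
right side is already at least 1. -/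
theorem one_sub_pow_le_rpow {δ z : ℝ} (hδ : 0 < δ) (hδ1 : δ ≤ 1) (hz : 0 ≤ z) (hz1 : z ≤ 1)
    (n : ℕ) : 1 - z ^ n ≤ (n : ℝ) ^ δ * (1 - z) ^ δ := by
  have h1 : 0 ≤ 1 - z := by linarith
  rw [← Real.mul_rpow (by positivity) h1]
  have hx : 0 ≤ (n : ℝ) * (1 - z) := by positivity
  rcases le_total ((n : ℝ) * (1 - z)) 1 with h | h
  · have hB := one_add_mul_le_pow (a := z - 1) (by linarith) n
    rw [add_sub_cancel] at hB
    calc 1 - z ^ n ≤ n * (1 - z) := by linarith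
      _ = (n * (1 - z)) ^ (1 : ℝ) := (Real.rpow_one _).symm
      _ ≤ _ := by
        rcases hx.eq_or_lt with h0 | h0
        · rw [← h0, Real.zero_rpow one_ne_zero, Real.zero_rpow hδ.ne']
        · exact Real.rpow_le_rpow_of_exponent_ge h0 h hδ1
  · exact (by linarith [pow_nonneg hz n] : 1 - z ^ n ≤ 1).trans (Real.one_le_rpow h hδ.le)

/-- A polynomial rate in Abel's limit theorem. -/
theorem abs_tsum_sub_tsum_mul_pow_le {b : ℕ → ℝ} {δ : ℝ} (hδ : 0 < δ) (hδ1 : δ ≤ 1)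
    (hb : Summable fun n => |b n| * (n : ℝ) ^ δ) (hs : Summable fun n => |b n|)
    {z : ℝ} (hz : 0 ≤ z) (hz1 : z ≤ 1) :
    |∑' n, b n - ∑' n, b n * z ^ n| ≤ (∑' n, |b n| * (n : ℝ) ^ δ) * (1 - z) ^ δ := by
  have hz' : ∀ n, z ^ n ≤ 1 := fun n => pow_le_one₀ hz hz1
  have hbz : Summable fun n => b n * z ^ n := by
    refine Summable.of_norm_bounded hs fun n => ?_
    rw [Real.norm_eq_abs, abs_mul, abs_of_nonneg (pow_nonneg hz n)]
    exact mul_le_of_le_one_right (abs_nonneg _) (hz' n)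
  rw [← hs.of_abs.tsum_sub hbz, ← Real.norm_eq_abs]
  refine tsum_of_norm_bounded (hb.hasSum.mul_right _) fun n => ?_
  rw [Real.norm_eq_abs, show b n - b n * z ^ n = b n * (1 - z ^ n) by ring, abs_mul,
    abs_of_nonneg (by linarith [hz' n] : 0 ≤ 1 - z ^ n), mul_assoc]
  exact mul_le_mul_of_nonneg_left (one_sub_pow_le_rpow hδ hδ1 hz hz1 n) (abs_nonneg _)

/-! ### Growth and convergence of truncated Euler sums -/

theorem abs_sign (m : ℤˣ) : |((m : ℤ) : ℝ)| = 1 := by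
  rcases Int.units_eq_one_or m with rfl | rfl <;> simp

theorem units_cast_mul_self (m : ℤˣ) : ((m : ℤ) : ℝ) * ((m : ℤ) : ℝ) = 1 := by
  rcases Int.units_eq_one_or m with rfl | rfl <;> simp

/-- Every summation costs at most one harmonic factor. The summand 1 in the base keeps the bound
valid when the sign list is too short and the sum defaults to 1. -/
theorem abs_truncEulerSum_le (s : List ℕ) : ∀ (μ : List ℤˣ), (∀ t ∈ s, 1 ≤ t) → ∀ M : ℕ,
    |truncEulerSum s μ M| ≤ (1 + (harmonic M : ℝ)) ^ s.length := by
  have hH : ∀ M : ℕ, (0 : ℝ) ≤ harmonic M := fun M => by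
    exact_mod_cast Finset.sum_nonneg fun i _ => by positivity
  have hmono : ∀ {m n : ℕ}, m ≤ n → (harmonic m : ℝ) ≤ harmonic n := fun {m n} h => by
    rw [Rat.cast_le]
    exact Finset.sum_le_sum_of_subset_of_nonneg (Finset.range_mono h) fun i _ _ => by positivity
  induction s with
  | nil => intro μ _ M; simp [truncEulerSum]
  | cons s₁ s ih =>
    intro μ hs M
    cases μ with
    | nil =>
      simp only [truncEulerSum, abs_one]
      exact one_le_pow₀ (by linarith [hH M])
    | cons μ₁ μ =>
      have hs1 : 1 ≤ s₁ := hs _ (by simp)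
      simp only [truncEulerSum, List.length_cons]
      calc _ ≤ ∑ n ∈ Finset.Icc 1 M, ((n : ℝ)⁻¹) * (1 + (harmonic M : ℝ)) ^ s.length := by
            refine (Finset.abs_sum_le_sum_abs _ _).trans (Finset.sum_le_sum fun n hn => ?_)
            obtain ⟨hn1, hn2⟩ := Finset.mem_Icc.1 hn
            have hn1' : (1 : ℝ) ≤ n := by exact_mod_cast hn1
            rw [abs_mul, abs_div, abs_pow, abs_sign, one_pow, abs_pow, Nat.abs_cast, one_div]
            refine mul_le_mul ?_ ((ih μ (fun t ht => hs t (by simp [ht])) _).trans ?_)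
              (abs_nonneg _) (by positivity)
            · gcongr
              exact le_self_pow₀ hn1' (by omega)
            · have := hmono (show n - 1 ≤ M by omega)
              have := hH (n - 1)
              gcongr
        _ = (harmonic M : ℝ) * (1 + (harmonic M : ℝ)) ^ s.length := by
            rw [← Finset.sum_mul, harmonic_eq_sum_Icc]; push_cast; rfl
        _ ≤ _ := by
            rw [pow_succ']
            have := hH M
            gcongr
            linarith

/-- The terms `μ₁ⁿ n^{-s₁} ζ^{(n-1)}(s; μ)` of the Euler sum `ζ(s₁, s; μ₁, μ)`. -/
noncomputable def eulerTerm (s₁ : ℕ) (s : List ℕ) (μ₁ : ℤˣ) (μ : List ℤˣ) (n : ℕ) : ℝ :=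
  ((μ₁ : ℤ) : ℝ) ^ n / (n : ℝ) ^ s₁ * truncEulerSum s μ (n - 1)

theorem sum_range_succ_eq_Icc {f : ℕ → ℝ} (h0 : f 0 = 0) (M : ℕ) :
    ∑ n ∈ Finset.range (M + 1), f n = ∑ n ∈ Finset.Icc 1 M, f n := by
  rw [Finset.range_eq_Ico, Finset.sum_eq_sum_Ico_succ_bot (by omega), h0, zero_add]
  rfl

/-- Since s₁ ≥ 1, the term at n = 0 is a division by zero and vanishes, so the sum becomes a partial
sum of a series indexed from 0. -/
theorem truncEulerSum_cons (s₁ : ℕ) (s : List ℕ) (μ₁ : ℤˣ) (μ : List ℤˣ) (h : 1 ≤ s₁) (M : ℕ) :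
    truncEulerSum (s₁ :: s) (μ₁ :: μ) M =
      ∑ n ∈ Finset.range (M + 1), eulerTerm s₁ s μ₁ μ n := by
  rw [sum_range_succ_eq_Icc]
  · rfl
  · simp [eulerTerm, show s₁ ≠ 0 by omega]

theorem one_add_harmonic_le {η : ℝ} (hη : 0 < η) {n : ℕ} (hn : 1 ≤ n) :
    1 + (harmonic (n - 1) : ℝ) ≤ (2 + 1 / η) * (n : ℝ) ^ η := by
  have hn' : (1 : ℝ) ≤ n := by exact_mod_cast hn
  have h1 : (harmonic (n - 1) : ℝ) ≤ harmonic n := by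
    rw [Rat.cast_le]
    exact Finset.sum_le_sum_of_subset_of_nonneg (Finset.range_mono (by omega))
      fun i _ _ => by positivity
  have h2 := harmonic_le_one_add_log n
  have h3 := Real.log_le_rpow_div (x := n) (by positivity) hη
  have h4 := Real.one_le_rpow hn' hη.le
  have h5 : (2 + 1 / η) * (n : ℝ) ^ η = 2 * (n : ℝ) ^ η + (n : ℝ) ^ η / η := by ring
  linarith

/-- Of the decay n⁻², one factor n^{1/4} pays for the powers of the logarithm and another for the
weight; the remaining n^{-3/2} is summable. -/
theorem summable_eulerTerm_mul_rpow {s₁ : ℕ} {s : List ℕ} (μ₁ : ℤˣ) (μ : List ℤˣ)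
    (h : 2 ≤ s₁) (hs : ∀ t ∈ s, 1 ≤ t) :
    Summable fun n : ℕ => |eulerTerm s₁ s μ₁ μ n| * (n : ℝ) ^ (1 / 4 : ℝ) := by
  set r := s.length
  -- Chosen so that r harmonic factors together cost at most n^{1/4}; r + 1 avoids dividing by zero
  -- in depth 0.
  set η : ℝ := 1 / (4 * (r + 1)) with hη
  have hη0 : 0 < η := by positivity
  have hr : η * r ≤ 1 / 4 := by
    rw [hη, div_mul_eq_mul_div, one_mul, div_le_div_iff₀ (by positivity) (by norm_num)]
    linarith
  have hK : 0 ≤ 2 + 1 / η := by positivity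
  have hsum : Summable fun n : ℕ => (2 + 1 / η) ^ r * (1 / (n : ℝ) ^ (3 / 2 : ℝ)) :=
    (Real.summable_one_div_nat_rpow.2 (by norm_num)).mul_left _
  refine Summable.of_nonneg_of_le (fun n => by positivity) (fun n => ?_) hsum
  rcases Nat.eq_zero_or_pos n with rfl | hn
  · rw [Nat.cast_zero, Real.zero_rpow (by norm_num), mul_zero]
    positivity
  have hn0 : (0 : ℝ) < n := by exact_mod_cast hn
  have hn1 : (1 : ℝ) ≤ n := by exact_mod_cast hn
  have hH : (0 : ℝ) ≤ harmonic (n - 1) := by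
    exact_mod_cast Finset.sum_nonneg fun i _ => by positivity
  have ht : |truncEulerSum s μ (n - 1)| ≤ (2 + 1 / η) ^ r * (n : ℝ) ^ (1 / 4 : ℝ) := by
    refine (abs_truncEulerSum_le s μ hs _).trans ?_
    refine (pow_le_pow_left₀ (by linarith) (one_add_harmonic_le hη0 hn) _).trans ?_
    rw [mul_pow, ← Real.rpow_natCast ((n : ℝ) ^ η), ← Real.rpow_mul hn0.le]
    gcongr
  rw [eulerTerm, abs_mul, abs_div, abs_pow, abs_sign, one_pow, abs_pow, Nat.abs_cast]
  calc 1 / (n : ℝ) ^ s₁ * |truncEulerSum s μ (n - 1)| * (n : ℝ) ^ (1 / 4 : ℝ)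
      ≤ 1 / (n : ℝ) ^ 2 * ((2 + 1 / η) ^ r * (n : ℝ) ^ (1 / 4 : ℝ)) * (n : ℝ) ^ (1 / 4 : ℝ) := by
        gcongr
    _ = (2 + 1 / η) ^ r * (1 / (n : ℝ) ^ (3 / 2 : ℝ)) := by
        have : (n : ℝ) ^ 2 = (n : ℝ) ^ (3 / 2 : ℝ) * (n : ℝ) ^ (1 / 4 : ℝ) * (n : ℝ) ^ (1 / 4 : ℝ) := by
          rw [← Real.rpow_add hn0, ← Real.rpow_add hn0, ← Real.rpow_natCast]
          norm_num
        rw [this]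
        field_simp

/-- The weight is at least 1 except at n = 0, where it vanishes; hence the shift by one. -/
theorem summable_abs_of_summable_mul_rpow {b : ℕ → ℝ} {δ : ℝ} (hδ : 0 < δ)
    (hb : Summable fun n : ℕ => |b n| * (n : ℝ) ^ δ) : Summable fun n => |b n| := by
  refine (summable_nat_add_iff 1).1 (Summable.of_nonneg_of_le (fun n => abs_nonneg _) (fun n => ?_)
    ((summable_nat_add_iff 1).2 hb))
  exact le_mul_of_one_le_right (abs_nonneg _)
    (Real.one_le_rpow (by push_cast; linarith [n.cast_nonneg (α := ℝ)]) hδ.le)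

theorem eulerSum_eq_of_tendsto {s : List ℕ} {μ : List ℤˣ} {c : ℝ}
    (h : Tendsto (truncEulerSum s μ) atTop (𝓝 c)) : eulerSum s μ = c :=
  h.limUnder_eq

theorem tendsto_truncEulerSum_tsum {s₁ : ℕ} {s : List ℕ} (μ₁ : ℤˣ) (μ : List ℤˣ)
    (h : 2 ≤ s₁) (hs : ∀ t ∈ s, 1 ≤ t) :
    Tendsto (truncEulerSum (s₁ :: s) (μ₁ :: μ)) atTop (𝓝 (∑' n, eulerTerm s₁ s μ₁ μ n)) := by
  have h1 := (summable_abs_of_summable_mul_rpow (by norm_num)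
    (summable_eulerTerm_mul_rpow μ₁ μ h hs)).of_abs.hasSum.tendsto_sum_nat
  refine (h1.comp (tendsto_add_atTop_nat 1)).congr fun M => ?_
  rw [truncEulerSum_cons _ _ _ _ (by omega)]
  rfl

theorem eulerSum_eq_tsum {s₁ : ℕ} {s : List ℕ} (μ₁ : ℤˣ) (μ : List ℤˣ)
    (h : 2 ≤ s₁) (hs : ∀ t ∈ s, 1 ≤ t) :
    eulerSum (s₁ :: s) (μ₁ :: μ) = ∑' n, eulerTerm s₁ s μ₁ μ n :=
  eulerSum_eq_of_tendsto (tendsto_truncEulerSum_tsum μ₁ μ h hs)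

theorem tendsto_truncEulerSum {s₁ : ℕ} {s : List ℕ} {μ : List ℤˣ}
    (h : 2 ≤ s₁) (hs : ∀ t ∈ s, 1 ≤ t) (hμ : μ.length = s.length + 1) :
    Tendsto (truncEulerSum (s₁ :: s) μ) atTop (𝓝 (eulerSum (s₁ :: s) μ)) := by
  obtain ⟨μ₁, μ, rfl⟩ := List.exists_cons_of_length_eq_add_one hμ
  rw [eulerSum_eq_tsum μ₁ μ h hs]
  exact tendsto_truncEulerSum_tsum μ₁ μ h hs

/-- The rate of convergence of an Euler sum with `s₁ ≥ 2`. -/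
theorem exists_abs_eulerSum_sub_truncEulerSum_le {s₁ : ℕ} {s : List ℕ} (μ₁ : ℤˣ) (μ : List ℤˣ)
    (h : 2 ≤ s₁) (hs : ∀ t ∈ s, 1 ≤ t) : ∃ K : ℝ, ∀ M : ℕ,
    |eulerSum (s₁ :: s) (μ₁ :: μ) - truncEulerSum (s₁ :: s) (μ₁ :: μ) M| *
      ((M + 1 : ℕ) : ℝ) ^ (1 / 4 : ℝ) ≤ K := by
  have hw := summable_eulerTerm_mul_rpow μ₁ μ h hs
  refine ⟨∑' n, |eulerTerm s₁ s μ₁ μ n| * (n : ℝ) ^ (1 / 4 : ℝ), fun M => ?_⟩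
  rw [eulerSum_eq_tsum μ₁ μ h hs, truncEulerSum_cons _ _ _ _ (by omega)]
  exact abs_tsum_sub_sum_range_mul_rpow_le (by norm_num) hw
    (summable_abs_of_summable_mul_rpow (by norm_num) hw).of_abs (M + 1)

/-! ### Asymptotic expansions that are linear in T -/

theorem tendsto_tsum_mul_one_sub_pow {f : ℕ → ℝ} {l : ℝ}
    (h : Tendsto (fun M => ∑ n ∈ Finset.range M, f n) atTop (𝓝 l)) :
    Tendsto (fun ε : ℝ => ∑' n, f n * (1 - ε) ^ n) (𝓝[>] 0) (𝓝 l) := by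
  refine (Real.tendsto_tsum_powerSeries_nhdsWithin_lt h).comp ?_
  refine tendsto_nhdsWithin_iff.2 ⟨?_, ?_⟩
  · refine tendsto_nhdsWithin_of_tendsto_nhds ?_
    simpa using (tendsto_const_nhds (x := (1 : ℝ))).sub (tendsto_id (α := ℝ) (x := 𝓝 0))
  · filter_upwards [self_mem_nhdsWithin] with ε (hε : 0 < ε)
    simpa using hε

theorem eventually_mem_Ioo_nhdsGT_zero : ∀ᶠ ε : ℝ in 𝓝[>] 0, ε ∈ Set.Ioo (0 : ℝ) 1 :=
  Ioo_mem_nhdsGT zero_lt_one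

theorem summable_of_abs_le_one_mul_pow {p : ℕ → ℝ} (hp : ∀ n, |p n| ≤ 1) {z : ℝ} (hz : 0 ≤ z)
    (hz1 : z < 1) : Summable fun n => p n * z ^ n := by
  refine Summable.of_norm_bounded (summable_geometric_of_lt_one hz hz1) fun n => ?_
  rw [Real.norm_eq_abs, abs_mul, abs_of_nonneg (pow_nonneg hz n)]
  exact mul_le_of_le_one_left (pow_nonneg hz n) (hp n)

theorem abs_sign_pow_div_le_one (m : ℤˣ) (n : ℕ) : |((m : ℤ) : ℝ) ^ n / n| ≤ 1 := by
  rw [abs_div, abs_pow, abs_sign, one_pow, Nat.abs_cast]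
  rcases Nat.eq_zero_or_pos n with rfl | hn
  · simp
  · rw [div_le_one (by positivity)]
    exact_mod_cast hn

/-- The common regularization of depth one and weight one: a polynomial of degree at most one. -/
theorem exists_reg_one (m : ℤˣ) : ∃ α β : ℝ,
    Tendsto (fun M : ℕ => ∑ n ∈ Finset.range (M + 1), ((m : ℤ) : ℝ) ^ n / n -
      (α * (Real.log M + Real.eulerMascheroniConstant) + β)) atTop (𝓝 0) ∧
    Tendsto (fun ε : ℝ => ∑' n : ℕ, ((m : ℤ) : ℝ) ^ n / n * (1 - ε) ^ n -
      (α * (-Real.log ε) + β)) (𝓝[>] 0) (𝓝 0) := by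
  rcases Int.units_eq_one_or m with rfl | rfl
  -- For sign 1 the truncations are the harmonic number and exactly -log ε; the constant γ in T
  -- makes both expansions equal to T.
  · refine ⟨1, 0, ?_, ?_⟩
    · have h := Real.tendsto_harmonic_sub_log.sub_const Real.eulerMascheroniConstant
      rw [sub_self] at h
      refine h.congr fun M => ?_
      rw [sum_range_succ_eq_Icc (by simp), harmonic_eq_sum_Icc]
      simp
      ring
    · refine tendsto_const_nhds.congr' ?_
      filter_upwards [eventually_mem_Ioo_nhdsGT_zero] with ε hε
      have h := Real.hasSum_pow_div_log_of_abs_lt_one (x := 1 - ε)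
        (by rw [abs_of_nonneg] <;> linarith [hε.1, hε.2])
      have h2 : HasSum (fun n : ℕ => (1 - ε) ^ n / n) (-Real.log ε) := by
        rw [← hasSum_nat_add_iff' 1]
        simpa using h
      rw [eq_comm, sub_eq_zero]
      simpa [div_eq_mul_inv, mul_comm] using h2.tsum_eq
  -- For sign -1 the series converges by Leibniz, so there is no linear term, and Abel's theorem
  -- gives the same constant for the integral.
  · obtain ⟨l, hl⟩ := Antitone.tendsto_alternating_series_of_tendsto_zero
      (f := fun n : ℕ => 1 / ((n : ℝ) + 1)) (fun a b h => by
        have : (a : ℝ) ≤ b := by exact_mod_cast h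
        show 1 / ((b : ℝ) + 1) ≤ 1 / ((a : ℝ) + 1)
        gcongr) tendsto_one_div_add_atTop_nhds_zero_nat
    have h1 : Tendsto (fun M => ∑ n ∈ Finset.range (M + 1), (((-1 : ℤˣ) : ℤ) : ℝ) ^ n / n)
        atTop (𝓝 (-l)) := by
      refine hl.neg.congr fun M => ?_
      rw [Finset.sum_range_succ', ← Finset.sum_neg_distrib]
      simp [pow_succ, div_eq_mul_inv]
    refine ⟨0, -l, ?_, ?_⟩
    · simpa using h1.sub_const (-l)
    · simpa using (tendsto_tsum_mul_one_sub_pow ((tendsto_add_atTop_iff_nat 1).1 h1)).sub_const (-l)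

/-- If `t` converges to `c` at a polynomial rate, then `∑ mⁿ t (n - 1) / n` has the same
asymptotic expansion for both regularizations, with linear coefficient proportional to `c`. -/
theorem exists_reg_of_rate (m : ℤˣ) {t : ℕ → ℝ} {c K : ℝ}
    (ht : ∀ M : ℕ, |c - t M| * ((M + 1 : ℕ) : ℝ) ^ (1 / 4 : ℝ) ≤ K) : ∃ P : ℝ[X],
    Tendsto (fun M : ℕ => ∑ n ∈ Finset.range (M + 1), ((m : ℤ) : ℝ) ^ n / n * t (n - 1) -
      P.eval (Real.log M + Real.eulerMascheroniConstant)) atTop (𝓝 0) ∧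
    Tendsto (fun ε : ℝ => ∑' n : ℕ, ((m : ℤ) : ℝ) ^ n / n * t (n - 1) * (1 - ε) ^ n -
      P.eval (-Real.log ε)) (𝓝[>] 0) (𝓝 0) := by
  obtain ⟨α, β, h1, h2⟩ := exists_reg_one m
  -- Split t as c plus an error. The constant part is c times the depth one case; the error terms
  -- are O(n^{-5/4}), hence contribute the same constant to partial sums and to Abel sums.
  set e : ℕ → ℝ := fun n => ((m : ℤ) : ℝ) ^ n / n * (t (n - 1) - c) with he
  have hK : 0 ≤ K := le_trans (by positivity) (ht 0)
  have hes : Summable fun n => |e n| := by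
    refine Summable.of_nonneg_of_le (fun n => abs_nonneg _) (fun n => ?_)
      ((Real.summable_one_div_nat_rpow (p := 5 / 4)).2 (by norm_num) |>.mul_left K)
    rcases Nat.eq_zero_or_pos n with rfl | hn
    · simp [he]
    · have hn0 : (0 : ℝ) < n := by exact_mod_cast hn
      have h := ht (n - 1)
      rw [Nat.sub_add_cancel hn, abs_sub_comm] at h
      rw [he]
      simp only
      rw [abs_mul, abs_div, abs_pow, abs_sign, one_pow, Nat.abs_cast,
        show (5 / 4 : ℝ) = 1 + 1 / 4 by norm_num, Real.rpow_add hn0, Real.rpow_one, mul_one_div,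
        le_div_iff₀ (by positivity)]
      refine le_trans (le_of_eq ?_) h
      field_simp
  have hl := hes.of_abs.hasSum.tendsto_sum_nat
  refine ⟨C (c * α) * X + C (c * β + ∑' n, e n), ?_, ?_⟩
  · have h3 := (h1.const_mul c).add (((tendsto_add_atTop_iff_nat 1).2 hl).sub_const (∑' n, e n))
    simp only [mul_zero, sub_self, add_zero] at h3
    refine h3.congr fun M => ?_
    have : ∑ n ∈ Finset.range (M + 1), ((m : ℤ) : ℝ) ^ n / n * t (n - 1) =
        c * ∑ n ∈ Finset.range (M + 1), ((m : ℤ) : ℝ) ^ n / n +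
          ∑ n ∈ Finset.range (M + 1), e n := by
      rw [Finset.mul_sum, ← Finset.sum_add_distrib]
      exact Finset.sum_congr rfl fun n _ => by simp only [he]; ring
    rw [this]
    simp only [eval_add, eval_mul, eval_C, eval_X]
    ring
  · have h3 := (h2.const_mul c).add ((tendsto_tsum_mul_one_sub_pow hl).sub_const (∑' n, e n))
    simp only [mul_zero, sub_self, add_zero] at h3
    refine h3.congr' ?_
    filter_upwards [eventually_mem_Ioo_nhdsGT_zero] with ε hε
    have hz : 0 ≤ 1 - ε := by linarith [hε.2]
    have hz1 : 1 - ε < 1 := by linarith [hε.1]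
    have hs1 := summable_of_abs_le_one_mul_pow (abs_sign_pow_div_le_one m) hz hz1
    have hs2 : Summable fun n => e n * (1 - ε) ^ n := by
      refine Summable.of_norm_bounded hes fun n => ?_
      rw [Real.norm_eq_abs, abs_mul, abs_of_nonneg (pow_nonneg hz n)]
      exact mul_le_of_le_one_right (abs_nonneg _) (pow_le_one₀ hz hz1.le)
    have : ∑' n : ℕ, ((m : ℤ) : ℝ) ^ n / n * t (n - 1) * (1 - ε) ^ n =
        c * ∑' n : ℕ, ((m : ℤ) : ℝ) ^ n / n * (1 - ε) ^ n + ∑' n, e n * (1 - ε) ^ n := by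
      rw [← tsum_mul_left, ← (hs1.mul_left c).tsum_add hs2]
      exact tsum_congr fun n => by simp only [he]; ring
    rw [this]
    simp only [eval_add, eval_mul, eval_C, eval_X]
    ring

/-- Asymptotics of a product in which the first factor grows at most linearly in `T`. -/
theorem tendsto_mul_sub_of_linear {ι : Type*} {l : Filter ι} {f g T : ι → ℝ} {α β c : ℝ}
    (hf : Tendsto (fun x => f x - (α * T x + β)) l (𝓝 0)) (hg : Tendsto g l (𝓝 c))
    (hT : Tendsto (fun x => T x * (g x - c)) l (𝓝 0)) :
    Tendsto (fun x => f x * g x - (c * α * T x + c * β)) l (𝓝 0) := by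
  -- Uses fg - c(αT + β) = (f - αT - β)g + αT(g - c) + β(g - c).
  have h := ((hf.mul hg).add (hT.const_mul α)).add ((hg.sub_const c).const_mul β)
  simp only [zero_mul, mul_zero, sub_self, add_zero] at h
  exact h.congr fun x => by ring

theorem tendsto_log_mul_of_rate {g : ℕ → ℝ} {c K : ℝ}
    (hg : ∀ M : ℕ, |c - g M| * ((M + 1 : ℕ) : ℝ) ^ (1 / 4 : ℝ) ≤ K) :
    Tendsto (fun M : ℕ => (Real.log M + Real.eulerMascheroniConstant) * (g M - c))
      atTop (𝓝 0) := by
  have h1 : Tendsto (fun M : ℕ => (Real.log M + Real.eulerMascheroniConstant) /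
      (M : ℝ) ^ (1 / 4 : ℝ)) atTop (𝓝 0) := by
    have h2 := ((isLittleO_log_rpow_atTop (r := 1 / 4) (by norm_num)).tendsto_div_nhds_zero).comp
      (tendsto_natCast_atTop_atTop (R := ℝ))
    have h3 := ((tendsto_rpow_atTop (y := 1 / 4) (by norm_num)).comp
      (tendsto_natCast_atTop_atTop (R := ℝ))).const_div_atTop Real.eulerMascheroniConstant
    have h4 := h2.add h3
    rw [add_zero] at h4
    refine h4.congr fun M => ?_
    simp only [Function.comp_apply]
    ring
  have h5 := (h1.abs).mul_const K
  simp only [abs_zero, zero_mul] at h5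
  refine squeeze_zero_norm' ?_ h5
  filter_upwards [eventually_gt_atTop 0] with M hM
  have hM0 : (0 : ℝ) < M := by exact_mod_cast hM
  have hM4 : 0 < (M : ℝ) ^ (1 / 4 : ℝ) := by positivity
  have h6 : |g M - c| * (M : ℝ) ^ (1 / 4 : ℝ) ≤ K := by
    refine le_trans ?_ (hg M)
    rw [abs_sub_comm]
    gcongr
    simp
  rw [Real.norm_eq_abs, abs_mul, abs_div, abs_of_pos hM4, div_mul_eq_mul_div, mul_div_assoc]
  gcongr
  rw [le_div_iff₀ hM4]
  exact h6

theorem tendsto_log_mul_of_rate_nhdsGT {g : ℝ → ℝ} {c K : ℝ}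
    (hg : ∀ᶠ ε in 𝓝[>] 0, |c - g ε| ≤ K * ε ^ (1 / 4 : ℝ)) :
    Tendsto (fun ε : ℝ => -Real.log ε * (g ε - c)) (𝓝[>] 0) (𝓝 0) := by
  have h1 := ((tendsto_log_mul_rpow_nhdsGT_zero (r := 1 / 4) (by norm_num)).abs).mul_const K
  simp only [abs_zero, zero_mul] at h1
  refine squeeze_zero_norm' ?_ h1
  filter_upwards [hg, eventually_mem_Ioo_nhdsGT_zero] with ε h hε
  rw [Real.norm_eq_abs, abs_mul, abs_neg, abs_mul, abs_sub_comm,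
    abs_of_nonneg (Real.rpow_nonneg hε.1.le _), mul_assoc]
  gcongr
  linarith

/-! ### Term-by-term integration of power series -/

section PowerSeries

variable {p : ℕ → ℝ}

theorem summable_add_one_mul_pow {r : ℝ} (hr : 0 ≤ r) (hr1 : r < 1) :
    Summable fun n : ℕ => ((n : ℝ) + 1) * r ^ n := by
  have h1 := summable_pow_mul_geometric_of_norm_lt_one (R := ℝ) 1 (r := r)
    (by rwa [Real.norm_eq_abs, abs_of_nonneg hr])
  refine (h1.add (summable_geometric_of_lt_one hr hr1)).congr fun n => ?_
  ring

theorem norm_mul_pow_le_of_abs_le (hp : ∀ n, |p n| ≤ n + 1) {r t : ℝ} (ht : |t| ≤ r) (n : ℕ) :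
    ‖p n * t ^ n‖ ≤ ((n : ℝ) + 1) * r ^ n := by
  rw [Real.norm_eq_abs, abs_mul, abs_pow]
  gcongr
  exact hp n

theorem continuousOn_tsum_mul_pow (hp : ∀ n, |p n| ≤ n + 1) :
    ContinuousOn (fun t : ℝ => ∑' n, p n * t ^ n) (Set.Ioo (-1) 1) := by
  intro x hx
  obtain ⟨r, hr, hr1⟩ := exists_between (abs_lt.2 hx)
  have h : ContinuousOn (fun t : ℝ => ∑' n, p n * t ^ n) (Set.Icc (-r) r) :=
    continuousOn_tsum (fun n => by fun_prop)
      (summable_add_one_mul_pow ((abs_nonneg x).trans hr.le) hr1)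
      fun n t ht => norm_mul_pow_le_of_abs_le hp (abs_le.2 ht) n
  have hx' := abs_lt.1 hr
  exact (h.continuousAt (Icc_mem_nhds hx'.1 hx'.2)).continuousWithinAt

/-- Dominated convergence with the bound (n + 1)zⁿ. Linear growth of the coefficients is allowed
because the integrands will be derivatives of series with bounded coefficients. -/
theorem hasSum_integral_mul_pow (hp : ∀ n, |p n| ≤ n + 1) {z : ℝ} (hz : 0 ≤ z) (hz1 : z < 1) :
    HasSum (fun n : ℕ => p n / ((n : ℝ) + 1) * z ^ (n + 1))
      (∫ t in (0 : ℝ)..z, ∑' n, p n * t ^ n) := by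
  have habs : ∀ t ∈ Set.uIoc 0 z, |t| ≤ z := fun t ht => by
    rw [Set.uIoc_of_le hz] at ht
    rw [abs_of_nonneg ht.1.le]
    exact ht.2
  have hsum := summable_add_one_mul_pow hz hz1
  have h := intervalIntegral.hasSum_integral_of_dominated_convergence (μ := MeasureTheory.volume)
    (a := 0) (b := z)
    (F := fun (n : ℕ) (t : ℝ) => p n * t ^ n) (f := fun t => ∑' n, p n * t ^ n)
    (fun n _ => ((n : ℝ) + 1) * z ^ n)
    (fun n => Continuous.aestronglyMeasurable (by fun_prop))
    (fun n => MeasureTheory.ae_of_all _ fun t ht => norm_mul_pow_le_of_abs_le hp (habs t ht) n)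
    (MeasureTheory.ae_of_all _ fun _ _ => hsum) intervalIntegrable_const
    (MeasureTheory.ae_of_all _ fun t ht => (Summable.of_norm_bounded hsum fun n =>
      norm_mul_pow_le_of_abs_le hp (habs t ht) n).hasSum)
  refine h.congr_fun fun n => ?_
  rw [intervalIntegral.integral_const_mul, integral_pow]
  simp
  ring

theorem hasDerivAt_integral_tsum_mul_pow (hp : ∀ n, |p n| ≤ n + 1) {z : ℝ} (hz : 0 ≤ z)
    (hz1 : z < 1) :
    HasDerivAt (fun u => ∫ t in (0 : ℝ)..u, ∑' n, p n * t ^ n) (∑' n, p n * z ^ n) z := by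
  have hc := continuousOn_tsum_mul_pow hp
  have hzm : z ∈ Set.Ioo (-1 : ℝ) 1 := ⟨by linarith, hz1⟩
  refine intervalIntegral.integral_hasDerivAt_right ?_
    (hc.stronglyMeasurableAtFilter isOpen_Ioo z hzm) (hc.continuousAt (isOpen_Ioo.mem_nhds hzm))
  refine (hc.mono ?_).intervalIntegrable
  rw [Set.uIcc_of_le hz]
  exact fun t ht => ⟨by linarith [ht.1], by linarith [ht.2]⟩

end PowerSeries

/-! ### Iterated integrals of words and their Taylor series -/

/-- The form `dt/t` (the letter `none`) or `dt/(a-t)` (the letter `some a`). -/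
noncomputable def letterForm : Option ℤˣ → ℝ → ℝ
  | none => fun t : ℝ => 1 / t
  | some a => fun t : ℝ => 1 / (((a : ℤ) : ℝ) - t)

/-- The iterated integral of a word in the forms `dt/t`, `dt/(a-t)`. -/
noncomputable def wordIntegral (w : List (Option ℤˣ)) : ℝ → ℝ :=
  iteratedIntegral (w.map letterForm)

/-- The word does not end in `dt/t`, so that its iterated integral converges at `0`. -/
def EndsInPole : List (Option ℤˣ) → Prop
  | [] => True
  | none :: w => w ≠ [] ∧ EndsInPole w
  | some _ :: w => EndsInPole w

/-- The Taylor coefficients at `0` of the iterated integral of a word. -/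
noncomputable def wordCoeff : List (Option ℤˣ) → ℕ → ℝ
  | [], n => if n = 0 then 1 else 0
  | none :: w, n => wordCoeff w n / n
  | some a :: w, n => (∑ k ∈ Finset.range n, ((a : ℤ) : ℝ) ^ (n - k) * wordCoeff w k) / n

theorem wordCoeff_cons_zero (l : Option ℤˣ) (w : List (Option ℤˣ)) : wordCoeff (l :: w) 0 = 0 := by
  cases l <;> simp [wordCoeff]

theorem abs_sum_sign_pow_mul_le {p : ℕ → ℝ} (hp : ∀ n, |p n| ≤ 1) (a : ℤˣ) (n : ℕ) :
    |∑ k ∈ Finset.range n, ((a : ℤ) : ℝ) ^ (n - k) * p k| ≤ n := by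
  refine (Finset.abs_sum_le_sum_abs _ _).trans ?_
  refine (Finset.sum_le_card_nsmul _ _ 1 fun k _ => ?_).trans (by simp)
  rw [abs_mul, abs_pow, abs_sign, one_pow, one_mul]
  exact hp k

/-- A pole letter replaces the coefficients by signed averages of the earlier ones, and dt/t divides
by n; neither increases the bound. -/
theorem abs_wordCoeff_le_one (w : List (Option ℤˣ)) : ∀ n, |wordCoeff w n| ≤ 1 := by
  induction w with
  | nil => intro n; simp only [wordCoeff]; split_ifs <;> simp
  | cons l w ih =>
    intro n
    rcases Nat.eq_zero_or_pos n with rfl | hn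
    · simp [wordCoeff_cons_zero]
    have hn1 : (1 : ℝ) ≤ n := by exact_mod_cast hn
    cases l with
    | none =>
      rw [wordCoeff, abs_div, Nat.abs_cast, div_le_one (by positivity)]
      exact (ih n).trans hn1
    | some a =>
      rw [wordCoeff, abs_div, Nat.abs_cast, div_le_one (by positivity)]
      exact abs_sum_sign_pow_mul_le ih a n

theorem summable_wordCoeff_mul_pow (w : List (Option ℤˣ)) {z : ℝ} (hz : 0 ≤ z) (hz1 : z < 1) :
    Summable fun n => wordCoeff w n * z ^ n :=
  summable_of_abs_le_one_mul_pow (abs_wordCoeff_le_one w) hz hz1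

/-- The Taylor coefficients of the derivative of the iterated integral of a word. -/
noncomputable def wordDerivCoeff (w : List (Option ℤˣ)) (n : ℕ) : ℝ :=
  ((n : ℝ) + 1) * wordCoeff w (n + 1)

theorem abs_wordDerivCoeff_le (w : List (Option ℤˣ)) (n : ℕ) : |wordDerivCoeff w n| ≤ n + 1 := by
  rw [wordDerivCoeff, abs_mul, abs_of_nonneg (by positivity : (0 : ℝ) ≤ n + 1)]
  exact mul_le_of_le_one_right (by positivity) (abs_wordCoeff_le_one w _)

/-- For dt/t the series is shifted, which requires a vanishing constant term: `EndsInPole` supplies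
it by making the remaining word nonempty. For dt/(a-t), the geometric expansion (using a⁻¹ = a) and
a Cauchy product give the recursion of `wordCoeff`. -/
theorem letterForm_mul_tsum_wordCoeff {l : Option ℤˣ} {w : List (Option ℤˣ)}
    (hw : EndsInPole (l :: w)) {t : ℝ} (ht : 0 < t) (ht1 : t < 1) :
    letterForm l t * ∑' n, wordCoeff w n * t ^ n = ∑' n, wordDerivCoeff (l :: w) n * t ^ n := by
  have hs := summable_wordCoeff_mul_pow w ht.le ht1
  cases l with
  | none =>
    obtain ⟨l', w', rfl⟩ := List.exists_cons_of_ne_nil hw.1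
    rw [hs.tsum_eq_zero_add, wordCoeff_cons_zero, zero_mul, zero_add, letterForm, ← tsum_mul_left]
    refine tsum_congr fun n => ?_
    rw [wordDerivCoeff, wordCoeff]
    have hn : (n : ℝ) + 1 ≠ 0 := by positivity
    push_cast
    field_simp
    ring
  | some a =>
    have ha := abs_sign a
    have hat : |((a : ℤ) : ℝ) * t| < 1 := by rw [abs_mul, ha, one_mul, abs_of_pos ht]; exact ht1
    have hgeo := (hasSum_geometric_of_abs_lt_one hat).mul_left ((a : ℤ) : ℝ)
    have hform : ((a : ℤ) : ℝ) * (1 - ((a : ℤ) : ℝ) * t)⁻¹ = letterForm (some a) t := by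
      have h2 : ((a : ℤ) : ℝ) - t = ((a : ℤ) : ℝ) * (1 - ((a : ℤ) : ℝ) * t) := by
        linear_combination t * units_cast_mul_self a
      have h3 : (((a : ℤ) : ℝ))⁻¹ = ((a : ℤ) : ℝ) := 
        inv_eq_of_mul_eq_one_left (units_cast_mul_self a)
      simp only [letterForm]
      rw [h2, one_div, mul_inv, h3]
    have hg : Summable fun n : ℕ => ‖((a : ℤ) : ℝ) * (((a : ℤ) : ℝ) * t) ^ n‖ :=
      hgeo.summable.norm
    have hprod := hasSum_sum_range_mul_of_summable_norm hs.norm hg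
    rw [← hform, ← hgeo.tsum_eq, mul_comm, ← hprod.tsum_eq]
    refine tsum_congr fun n => ?_
    have hn : (n : ℝ) + 1 ≠ 0 := by positivity
    rw [wordDerivCoeff, wordCoeff]
    push_cast
    rw [mul_div_cancel₀ _ hn, Finset.sum_mul]
    refine Finset.sum_congr rfl fun k hk => ?_
    have hk' : k ≤ n := Nat.lt_succ_iff.1 (Finset.mem_range.1 hk)
    obtain ⟨j, rfl⟩ := Nat.exists_eq_add_of_le hk'
    rw [show k + j + 1 - k = j + 1 by omega, show k + j - k = j by omega, mul_pow, pow_add t,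
      pow_succ]
    ring

theorem EndsInPole.of_cons {l : Option ℤˣ} {w : List (Option ℤˣ)} (h : EndsInPole (l :: w)) :
    EndsInPole w := by
  cases l with
  | none => exact h.2
  | some a => exact h

theorem wordIntegral_cons (l : Option ℤˣ) (w : List (Option ℤˣ)) (z : ℝ) :
    wordIntegral (l :: w) z = ∫ t in (0 : ℝ)..z, letterForm l t * wordIntegral w t := rfl

theorem integral_tsum_wordDerivCoeff (l : Option ℤˣ) (w : List (Option ℤˣ)) {z : ℝ} (hz : 0 ≤ z)
    (hz1 : z < 1) :
    ∫ t in (0 : ℝ)..z, ∑' n, wordDerivCoeff (l :: w) n * t ^ n =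
      ∑' n, wordCoeff (l :: w) n * z ^ n := by
  rw [← (hasSum_integral_mul_pow (abs_wordDerivCoeff_le (l :: w)) hz hz1).tsum_eq,
    (summable_wordCoeff_mul_pow (l :: w) hz hz1).tsum_eq_zero_add, wordCoeff_cons_zero, zero_mul,
    zero_add]
  refine tsum_congr fun n => ?_
  have hn : (n : ℝ) + 1 ≠ 0 := by positivity
  rw [wordDerivCoeff, mul_div_cancel_left₀ _ hn]

/-- The iterated integral of a word is given by its Taylor series on `[0, 1)`. -/
theorem wordIntegral_eq_tsum {w : List (Option ℤˣ)} (hw : EndsInPole w) :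
    ∀ {z : ℝ}, 0 ≤ z → z < 1 → wordIntegral w z = ∑' n, wordCoeff w n * z ^ n := by
  induction w with
  | nil =>
    intro z _ _
    rw [tsum_eq_single 0 fun n hn => by simp [wordCoeff, hn]]
    simp [wordCoeff, wordIntegral, iteratedIntegral]
  | cons l w ih =>
    intro z hz hz1
    rw [wordIntegral_cons, ← integral_tsum_wordDerivCoeff l w hz hz1]
    refine intervalIntegral.integral_congr_Ioo_of_le hz fun t ht => ?_
    have ht1 : t < 1 := ht.2.trans hz1
    -- The integrands are compared only inside the interval, since the product formula can fail at t
    -- = 0.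
    rw [ih hw.of_cons ht.1.le ht1, letterForm_mul_tsum_wordCoeff hw ht.1 ht1]

theorem continuousOn_wordIntegral {w : List (Option ℤˣ)} (hw : EndsInPole w) :
    ContinuousOn (wordIntegral w) (Set.Ico 0 1) := by
  have h := continuousOn_tsum_mul_pow (p := wordCoeff w)
    fun n => (abs_wordCoeff_le_one w n).trans (by simp)
  exact (h.mono fun t ht => ⟨by linarith [ht.1], ht.2⟩).congr fun t ht =>
    wordIntegral_eq_tsum hw ht.1 ht.2

theorem wordIntegral_cons_zero (l : Option ℤˣ) (w : List (Option ℤˣ)) :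
    wordIntegral (l :: w) 0 = 0 := by
  rw [wordIntegral_cons, intervalIntegral.integral_same]

/-- The integrand is replaced by its power series, which is continuous across 0, so that the
fundamental theorem of calculus applies despite the factor 1/t. -/
theorem hasDerivAt_wordIntegral {l : Option ℤˣ} {w : List (Option ℤˣ)} (hw : EndsInPole (l :: w))
    {z : ℝ} (hz : 0 < z) (hz1 : z < 1) :
    HasDerivAt (wordIntegral (l :: w)) (letterForm l z * wordIntegral w z) z := by
  have h := hasDerivAt_integral_tsum_mul_pow (abs_wordDerivCoeff_le (l :: w)) hz.le hz1
  rw [← letterForm_mul_tsum_wordCoeff hw hz hz1, ← wordIntegral_eq_tsum hw.of_cons hz.le hz1] at h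
  refine h.congr_of_eventuallyEq ?_
  filter_upwards [Ioo_mem_nhds hz hz1] with u hu
  rw [wordIntegral_eq_tsum hw hu.1.le hu.2, integral_tsum_wordDerivCoeff l w hu.1.le hu.2]

/-! ### Shuffling one letter into a word -/

theorem EndsInPole.insertIdx {w : List (Option ℤˣ)} (hw : EndsInPole w) (a : ℤˣ) :
    ∀ i : ℕ, EndsInPole (w.insertIdx i (some a)) := by
  induction w with
  | nil => intro i; cases i <;> simp [EndsInPole]
  | cons l w ih =>
    intro i
    cases i with
    | zero => simpa [EndsInPole] using hw
    | succ i =>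
      rw [List.insertIdx_succ_cons]
      cases l with
      | none =>
        refine ⟨?_, ih hw.2 i⟩
        have h1 : w.length ≤ (w.insertIdx i (some a)).length := List.length_le_length_insertIdx
        have h2 := List.length_pos_of_ne_nil hw.1
        exact List.ne_nil_of_length_pos (by omega)
      | some b => exact ih hw i

/-- The shuffle product of the letter `dt/(a-t)` with a word. -/
theorem wordIntegral_singleton_mul (a : ℤˣ) {w : List (Option ℤˣ)} (hw : EndsInPole w) :
    ∀ {z : ℝ}, 0 ≤ z → z < 1 → wordIntegral [some a] z * wordIntegral w z =
      ∑ i ∈ Finset.range (w.length + 1), wordIntegral (w.insertIdx i (some a)) z := by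
  induction w with
  | nil => intro z _ _; simp [wordIntegral, iteratedIntegral]
  | cons l w ih =>
    intro z hz hz1
    rcases hz.eq_or_lt with rfl | hz0
    · rw [wordIntegral_cons_zero, zero_mul, Finset.sum_eq_zero]
      intro i _
      cases i with
      | zero => exact wordIntegral_cons_zero _ _
      | succ i => rw [List.insertIdx_succ_cons]; exact wordIntegral_cons_zero _ _
    have ha : EndsInPole [some a] := trivial
    have hal : EndsInPole (some a :: l :: w) := hw
    have hins : ∀ i, EndsInPole (l :: w.insertIdx i (some a)) := fun i => hw.insertIdx a (i + 1)
    -- The difference of the two sides. In the product rule, differentiating the single letter gives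
    -- the word with `some a` in front; differentiating the other factor gives the insertions behind
    -- `l`, by induction. So D' = 0, and D(0) = 0.
    set D : ℝ → ℝ := fun z => wordIntegral [some a] z * wordIntegral (l :: w) z -
      (∑ i ∈ Finset.range (w.length + 1), wordIntegral (l :: w.insertIdx i (some a)) z +
        wordIntegral (some a :: l :: w) z) with hD
    have hcont : ContinuousOn D (Set.Icc 0 z) := by
      have hsub : Set.Icc 0 z ⊆ Set.Ico (0 : ℝ) 1 := fun t ht => ⟨ht.1, ht.2.trans_lt hz1⟩
      refine ContinuousOn.mono ?_ hsub
      exact ((continuousOn_wordIntegral ha).mul (continuousOn_wordIntegral hw)).sub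
        ((continuousOn_finsetSum _ fun i _ => continuousOn_wordIntegral (hins i)).add
          (continuousOn_wordIntegral hal))
    have hderiv : ∀ t ∈ Set.Ioo 0 z, HasDerivAt D 0 t := by
      intro t ht
      have ht1 : t < 1 := ht.2.trans hz1
      have h := ((hasDerivAt_wordIntegral ha ht.1 ht1).mul
        (hasDerivAt_wordIntegral hw ht.1 ht1)).sub
        ((HasDerivAt.fun_sum (u := Finset.range (w.length + 1)) fun i _ =>
          hasDerivAt_wordIntegral (hins i) ht.1 ht1).add (hasDerivAt_wordIntegral hal ht.1 ht1))
      refine h.congr_deriv ?_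
      rw [← Finset.mul_sum, ← ih hw.of_cons ht.1.le ht1]
      have : wordIntegral [] t = 1 := rfl
      rw [this]
      ring
    obtain ⟨c, -, hc⟩ := exists_hasDerivAt_eq_slope D (fun _ => 0) hz0 hcont hderiv
    have h0 : D 0 = 0 := by simp [hD, wordIntegral_cons_zero]
    rw [h0, eq_comm, sub_zero, sub_zero, div_eq_zero_iff] at hc
    rw [List.length_cons, Finset.sum_range_succ']
    simp only [List.insertIdx_succ_cons, List.insertIdx_zero]
    exact sub_eq_zero.1 (hc.resolve_right hz0.ne')

/-! ### From words to Euler sums -/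

/-- The word of `dt/t` and `dt/(a_i-t)` underlying `eulerForms`. -/
def eulerWord : ℤˣ → List ℕ → List ℤˣ → List (Option ℤˣ)
  | a, s₁ :: s, μ₁ :: μ => List.replicate (s₁ - 1) none ++ some (a * μ₁) :: eulerWord (a * μ₁) s μ
  | _, _, _ => []

theorem map_letterForm_eulerWord (s : List ℕ) : ∀ (a : ℤˣ) (μ : List ℤˣ),
    (eulerWord a s μ).map letterForm = eulerForms a s μ := by
  induction s with
  | nil => intro a μ; simp [eulerWord, eulerForms]
  | cons s₁ s ih =>
    intro a μ
    cases μ with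
    | nil => simp [eulerWord, eulerForms]
    | cons μ₁ μ => simp [eulerWord, eulerForms, ih, letterForm]

theorem endsInPole_replicate_append (k : ℕ) (a : ℤˣ) {w : List (Option ℤˣ)} (hw : EndsInPole w) :
    EndsInPole (List.replicate k none ++ some a :: w) := by
  induction k with
  | zero => simpa [EndsInPole] using hw
  | succ k ih => rw [List.replicate_succ, List.cons_append]; exact ⟨by simp, ih⟩

theorem endsInPole_eulerWord (s : List ℕ) : ∀ (a : ℤˣ) (μ : List ℤˣ),
    EndsInPole (eulerWord a s μ) := by
  induction s with
  | nil => intro a μ; simp [eulerWord, EndsInPole]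
  | cons s₁ s ih =>
    intro a μ
    cases μ with
    | nil => simp [eulerWord, EndsInPole]
    | cons μ₁ μ => exact endsInPole_replicate_append _ _ (ih _ _)

theorem wordCoeff_replicate_append (k : ℕ) (w : List (Option ℤˣ)) (n : ℕ) :
    wordCoeff (List.replicate k none ++ w) n = wordCoeff w n / (n : ℝ) ^ k := by
  induction k with
  | zero => simp
  | succ k ih => rw [List.replicate_succ, List.cons_append, wordCoeff, ih, pow_succ, div_div]

/-- The poles are partial products so that signs telescope: with pole p outside and pμ₂ inside,
p^{n-k}(pμ₂)^k = pⁿμ₂^k. -/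
theorem wordCoeff_eulerWord (s : List ℕ) : ∀ (s₁ : ℕ) (a μ₁ : ℤˣ) (μ : List ℤˣ),
    1 ≤ s₁ → (∀ t ∈ s, 1 ≤ t) → μ.length = s.length → ∀ n : ℕ,
    wordCoeff (eulerWord a (s₁ :: s) (μ₁ :: μ)) n = eulerTerm s₁ s (a * μ₁) μ n := by
  induction s with
  | nil =>
    intro s₁ a μ₁ μ h1 _ hμ n
    rcases Nat.eq_zero_or_pos n with rfl | hn
    · simp [eulerWord, wordCoeff_replicate_append, wordCoeff, eulerTerm, show s₁ ≠ 0 by omega]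
    rw [eulerWord, wordCoeff_replicate_append, wordCoeff, Finset.sum_eq_single_of_mem 0
      (Finset.mem_range.2 hn) fun k _ hk => by simp [eulerWord, wordCoeff, hk]]
    simp only [eulerWord, wordCoeff, eulerTerm, truncEulerSum, if_true, mul_one, Nat.sub_zero]
    rw [div_div, ← pow_succ', Nat.sub_add_cancel h1]
  | cons s₂ s ih =>
    intro s₁ a μ₁ μ h1 hs hμ n
    obtain ⟨μ₂, μ, rfl⟩ := List.exists_cons_of_length_eq_add_one hμ
    have h2 : 1 ≤ s₂ := hs _ (by simp)
    rw [eulerWord, wordCoeff_replicate_append, wordCoeff, div_div, ← pow_succ',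
      Nat.sub_add_cancel h1]
    rcases Nat.eq_zero_or_pos n with rfl | hn
    · simp [eulerTerm, show s₁ ≠ 0 by omega]
    obtain ⟨m, rfl⟩ := Nat.exists_eq_add_of_lt hn
    rw [eulerTerm, div_mul_eq_mul_div, zero_add, Nat.add_sub_cancel,
      truncEulerSum_cons _ _ _ _ h2, Finset.mul_sum]
    congr 1
    refine Finset.sum_congr rfl fun k hk => ?_
    have hk' : k ≤ m + 1 := (Finset.mem_range.1 hk).le
    rw [ih s₂ (a * μ₁) μ₂ μ h2 (fun t ht => hs t (by simp [ht])) (by simpa using hμ),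
      ← Nat.sub_add_cancel hk', pow_add _ (m + 1 - k) k, Nat.add_sub_cancel]
    simp only [eulerTerm, Units.val_mul, Int.cast_mul]
    ring

/-- The truncated iterated integral is an Abel sum of the Euler sum. -/
theorem truncEulerIntegral_eq_tsum {s₁ : ℕ} {s : List ℕ} {μ₁ : ℤˣ} {μ : List ℤˣ} (h1 : 1 ≤ s₁)
    (hs : ∀ t ∈ s, 1 ≤ t) (hμ : μ.length = s.length) {ε : ℝ} (hε : ε ∈ Set.Ioo (0 : ℝ) 1) :
    truncEulerIntegral (s₁ :: s) (μ₁ :: μ) ε = ∑' n, eulerTerm s₁ s μ₁ μ n * (1 - ε) ^ n := by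
  rw [truncEulerIntegral, ← map_letterForm_eulerWord]
  refine (wordIntegral_eq_tsum (endsInPole_eulerWord _ _ _) (by linarith [hε.2])
    (by linarith [hε.1])).trans (tsum_congr fun n => ?_)
  rw [wordCoeff_eulerWord s s₁ 1 μ₁ μ h1 hs hμ, one_mul]

theorem truncEulerIntegral_eq_wordIntegral (s : List ℕ) (μ : List ℤˣ) (ε : ℝ) :
    truncEulerIntegral s μ ε = wordIntegral (eulerWord 1 s μ) (1 - ε) := by
  rw [truncEulerIntegral, ← map_letterForm_eulerWord]
  rfl

/-! ### Existence and agreement of the regularizations -/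

theorem tendsto_truncEulerIntegral {s₁ : ℕ} {s : List ℕ} {μ : List ℤˣ} (h : 2 ≤ s₁)
    (hs : ∀ t ∈ s, 1 ≤ t) (hμ : μ.length = s.length + 1) :
    Tendsto (truncEulerIntegral (s₁ :: s) μ) (𝓝[>] 0) (𝓝 (eulerSum (s₁ :: s) μ)) := by
  have hT := tendsto_truncEulerSum h hs hμ
  obtain ⟨μ₁, μ, rfl⟩ := List.exists_cons_of_length_eq_add_one hμ
  have hT' : Tendsto (fun M => ∑ n ∈ Finset.range M, eulerTerm s₁ s μ₁ μ n) atTop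
      (𝓝 (eulerSum (s₁ :: s) (μ₁ :: μ))) :=
    (tendsto_add_atTop_iff_nat 1).1
      (hT.congr fun M => truncEulerSum_cons s₁ s μ₁ μ (by omega) M)
  refine (tendsto_tsum_mul_one_sub_pow hT').congr' ?_
  filter_upwards [eventually_mem_Ioo_nhdsGT_zero] with ε hε
  rw [truncEulerIntegral_eq_tsum (by omega) hs (by simpa using hμ) hε]

theorem isShuffleReg_C_eulerSum {s₁ : ℕ} {s : List ℕ} {μ : List ℤˣ} (h : 2 ≤ s₁)
    (hs : ∀ t ∈ s, 1 ≤ t) (hμ : μ.length = s.length + 1) :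
    IsShuffleReg (s₁ :: s) μ (C (eulerSum (s₁ :: s) μ)) := by
  simpa [IsShuffleReg] using (tendsto_truncEulerIntegral h hs hμ).sub_const (eulerSum (s₁ :: s) μ)

/-- With a single leading `1`, the two regularizations exist and coincide. -/
theorem exists_isStarReg_isShuffleReg {q : ℕ} {s : List ℕ} {μ : List ℤˣ} (h : 2 ≤ q)
    (hs : ∀ t ∈ s, 1 ≤ t) (hμ : μ.length = s.length + 2) :
    ∃ P : ℝ[X], IsStarReg (1 :: q :: s) μ P ∧ IsShuffleReg (1 :: q :: s) μ P := by
  obtain ⟨m, μ, rfl⟩ := List.exists_cons_of_length_eq_add_one hμ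
  obtain ⟨μ₁, μ, rfl⟩ := List.exists_cons_of_length_eq_add_one (l := μ) (n := s.length)
    (by simpa using hμ)
  obtain ⟨K, hK⟩ := exists_abs_eulerSum_sub_truncEulerSum_le μ₁ μ h hs
  obtain ⟨P, hP1, hP2⟩ := exists_reg_of_rate m hK
  refine ⟨P, hP1.congr fun M => ?_, hP2.congr' ?_⟩
  · rw [truncEulerSum_cons _ _ _ _ le_rfl]
    simp only [eulerTerm, pow_one]
  · filter_upwards [eventually_mem_Ioo_nhdsGT_zero] with ε hε
    rw [truncEulerIntegral_eq_tsum le_rfl _ (by simpa using hμ) hε]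
    · simp only [eulerTerm, pow_one]
    · simpa [show 1 ≤ q by omega] using hs

/-- The products of `ζ(1; m)` with an Euler sum with `s₁ ≥ 2` have the same asymptotic expansion
for both truncations. -/
theorem exists_reg_one_mul {q : ℕ} {s : List ℕ} {μ : List ℤˣ} (m : ℤˣ) (h : 2 ≤ q)
    (hs : ∀ t ∈ s, 1 ≤ t) (hμ : μ.length = s.length + 1) : ∃ P : ℝ[X],
    Tendsto (fun M : ℕ => truncEulerSum [1] [m] M * truncEulerSum (q :: s) μ M -
      P.eval (Real.log M + Real.eulerMascheroniConstant)) atTop (𝓝 0) ∧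
    Tendsto (fun ε : ℝ => truncEulerIntegral [1] [m] ε * truncEulerIntegral (q :: s) μ ε -
      P.eval (-Real.log ε)) (𝓝[>] 0) (𝓝 0) := by
  have hT := tendsto_truncEulerSum h hs hμ
  have hI := tendsto_truncEulerIntegral h hs hμ
  obtain ⟨μ₁, μ, rfl⟩ := List.exists_cons_of_length_eq_add_one hμ
  obtain ⟨K, hK⟩ := exists_abs_eulerSum_sub_truncEulerSum_le μ₁ μ h hs
  obtain ⟨α, β, h1, h2⟩ := exists_reg_one m
  set c := eulerSum (q :: s) (μ₁ :: μ) with hc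
  have hw := summable_eulerTerm_mul_rpow μ₁ μ h hs
  have hterm : ∀ n, eulerTerm 1 [] m [] n = ((m : ℤ) : ℝ) ^ n / n := fun n => by
    simp [eulerTerm, truncEulerSum]
  refine ⟨C (c * α) * X + C (c * β), ?_, ?_⟩
  · refine (tendsto_mul_sub_of_linear (f := truncEulerSum [1] [m]) (α := α) (β := β) (h1.congr fun M => ?_) hT
      (tendsto_log_mul_of_rate hK)).congr fun M => ?_
    · simp only [truncEulerSum_cons _ _ _ _ le_rfl, hterm]
    · simp
  · refine (tendsto_mul_sub_of_linear (f := truncEulerIntegral [1] [m]) (α := α) (β := β) (h2.congr' ?_) hI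
      (tendsto_log_mul_of_rate_nhdsGT
        (K := ∑' n, |eulerTerm q s μ₁ μ n| * (n : ℝ) ^ (1 / 4 : ℝ)) ?_)).congr fun ε => ?_
    · filter_upwards [eventually_mem_Ioo_nhdsGT_zero] with ε hε
      rw [truncEulerIntegral_eq_tsum le_rfl (by simp) rfl hε]
      simp only [hterm]
    · filter_upwards [eventually_mem_Ioo_nhdsGT_zero] with ε hε
      rw [truncEulerIntegral_eq_tsum (by omega) hs (by simpa using hμ) hε, hc,
        eulerSum_eq_tsum μ₁ μ h hs]
      have := abs_tsum_sub_tsum_mul_pow_le (δ := 1 / 4) (by norm_num) (by norm_num) hw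
        (summable_abs_of_summable_mul_rpow (by norm_num) hw) (z := 1 - ε)
        (by linarith [hε.2]) (by linarith [hε.1])
      rwa [sub_sub_cancel] at this
    · simp

/-! ### Stuffle product with a depth one sum -/

theorem truncEulerSum_cons_succ (s₁ : ℕ) (s : List ℕ) (μ₁ : ℤˣ) (μ : List ℤˣ) (M : ℕ) :
    truncEulerSum (s₁ :: s) (μ₁ :: μ) (M + 1) = truncEulerSum (s₁ :: s) (μ₁ :: μ) M +
      ((μ₁ : ℤ) : ℝ) ^ (M + 1) / ((M + 1 : ℕ) : ℝ) ^ s₁ * truncEulerSum s μ M := by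
  simp only [truncEulerSum]
  rw [Finset.sum_Icc_succ_top (by omega), Nat.add_sub_cancel]

/-- The stuffle product of a depth one truncated Euler sum with a truncated Euler sum. -/
theorem truncEulerSum_singleton_mul (k : ℕ) (m : ℤˣ) (s : List ℕ) : ∀ (μ : List ℤˣ),
    μ.length = s.length → ∀ M : ℕ,
    truncEulerSum [k] [m] M * truncEulerSum s μ M =
      ∑ i ∈ Finset.range (s.length + 1),
        truncEulerSum (s.insertIdx i k) (μ.insertIdx i m) M +
      ∑ i ∈ Finset.range s.length,
        truncEulerSum (s.modify i (k + ·)) (μ.modify i (m * ·)) M := by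
  induction s with
  | nil => intro μ hμ M; rw [List.length_eq_zero_iff.1 hμ]; simp [truncEulerSum]
  | cons s₁ s ih =>
    intro μ hμ M
    obtain ⟨μ₁, μ, rfl⟩ := List.exists_cons_of_length_eq_add_one hμ
    replace ih := ih μ (by simpa using hμ)
    rw [List.length_cons, Finset.sum_range_succ', Finset.sum_range_succ'
      (fun i => truncEulerSum ((s₁ :: s).modify i (k + ·)) ((μ₁ :: μ).modify i (m * ·)) M)]
    simp only [List.insertIdx_succ_cons, List.insertIdx_zero, List.modify_succ_cons,
      List.modify_zero_cons]
    -- Both factors gain a term at M + 1. The cross terms put the new index in front or, by the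
    -- depth induction at M, behind the first entry; the product of the two gains is the merged
    -- entry.
    induction M with
    | zero => simp [truncEulerSum]
    | succ M ihM =>
      simp only [truncEulerSum_cons_succ, Finset.sum_add_distrib,
        ← Finset.mul_sum] at ihM ⊢
      have h0 : truncEulerSum [] [] M = 1 := rfl
      have h1 := ih M
      simp only [Units.val_mul, Int.cast_mul, mul_pow, pow_add _ k s₁, h0]
      linear_combination ihM + (((μ₁ : ℤ) : ℝ) ^ (M + 1) / ((M + 1 : ℕ) : ℝ) ^ s₁) * h1

/-! ### Lists of ones and segments of signs -/

section Lists

theorem insertIdx_append_length_add {α : Type*} (A B : List α) (x : α) (j : ℕ) :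
    (A ++ B).insertIdx (A.length + j) x = A ++ B.insertIdx j x := by
  induction A with
  | nil => simp
  | cons a A ih => simp [Nat.add_right_comm _ 1 j, ih]

theorem insertIdx_append_length {α : Type*} (A B : List α) (x : α) :
    (A ++ B).insertIdx A.length x = A ++ x :: B :=
  insertIdx_append_length_add A B x 0

theorem modify_append_length {α : Type*} (A B : List α) (x : α) (f : α → α) :
    (A ++ x :: B).modify A.length f = A ++ f x :: B := by
  induction A with
  | nil => simp
  | cons a A ih => simp [ih]

theorem length_ones (n : ℕ) : (ones n).length = n := List.length_replicate

theorem one_le_of_mem_ones {n t : ℕ} (h : t ∈ ones n) : 1 ≤ t :=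
  (List.eq_of_mem_replicate h).ge

theorem ones_succ (n : ℕ) : ones (n + 1) = 1 :: ones n := List.replicate_succ

theorem ones_add (m n : ℕ) : ones (m + n) = ones m ++ ones n :=
  List.replicate_add m n 1

variable (ν : ℕ → ℤˣ)

theorem length_seg (i k : ℕ) : (seg ν i k).length = k + 1 - i := by simp [seg]

theorem seg_cons {i k : ℕ} (h : i ≤ k) : seg ν i k = ν i :: seg ν (i + 1) k := by
  simp only [seg]
  rw [show k + 1 - i = (k + 1 - (i + 1)) + 1 by omega, List.range'_succ, List.map_cons]

theorem seg_eq_nil {i k : ℕ} (h : k < i) : seg ν i k = [] := by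
  simp [seg, show k + 1 - i = 0 by omega]

theorem seg_append {i k l : ℕ} (h : i ≤ k + 1) (h' : k ≤ l) :
    seg ν i k ++ seg ν (k + 1) l = seg ν i l := by
  simp only [seg]
  rw [← List.map_append]
  congr 1
  have := List.range'_append (s := i) (m := k + 1 - i) (n := l + 1 - (k + 1)) (step := 1)
  rw [show i + 1 * (k + 1 - i) = k + 1 by omega] at this
  rw [this]
  congr 1
  omega

theorem prod_seg (i k : ℕ) : (seg ν i k).prod = ∏ j ∈ Finset.Icc i k, ν j :=
  (Multiset.prod_coe _).symm

variable {ν}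

theorem seg_congr {μ : ℕ → ℤˣ} {i k : ℕ} (h : ∀ j, i ≤ j → ν j = μ j) : seg ν i k = seg μ i k :=
  List.map_congr_left fun _ hj => h _ (List.mem_range'_1.1 hj).1

variable (ν)

theorem insertIdx_ones {j d : ℕ} (h : j ≤ d) : (ones d).insertIdx j 1 = ones (d + 1) := by
  obtain ⟨e, rfl⟩ := Nat.exists_eq_add_of_le h
  have := insertIdx_append_length (ones j) (ones e) 1
  rw [length_ones] at this
  rw [ones_add, this, ← ones_succ, ← ones_add, add_assoc]

theorem modify_ones {j d : ℕ} (h : j < d) :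
    (ones d).modify j (1 + ·) = ones j ++ [2] ++ ones (d - 1 - j) := by
  obtain ⟨e, rfl⟩ := Nat.exists_eq_add_of_lt h
  have := modify_append_length (ones j) (ones e) 1 (1 + ·)
  rw [length_ones] at this
  rw [add_assoc, ones_add, ones_succ, this, show j + (e + 1) - 1 - j = e by omega]
  simp

theorem insertIdx_seg {i j k : ℕ} (h : i ≤ j + 1) (h' : j ≤ k) (x : ℤˣ) :
    (seg ν i k).insertIdx (j + 1 - i) x = seg ν i j ++ [x] ++ seg ν (j + 1) k := by
  rw [← seg_append ν h h', ← length_seg ν i j, insertIdx_append_length]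
  simp

theorem modify_seg {i j k : ℕ} (h : i ≤ j + 1) (h' : j < k) (f : ℤˣ → ℤˣ) :
    (seg ν i k).modify (j + 1 - i) f = seg ν i j ++ [f (ν (j + 1))] ++ seg ν (j + 2) k := by
  rw [← seg_append ν h h'.le, seg_cons ν (show j + 1 ≤ k from h'), ← length_seg ν i j,
    modify_append_length]
  simp

end Lists

/-! ### Inserting a pole into the word of a string of ones -/

theorem length_eulerWord_ones (d : ℕ) : ∀ (a : ℤˣ) (l : List ℤˣ), l.length = d →
    (eulerWord a (ones d) l).length = d := by
  induction d with
  | zero => intro a l _; simp [ones, eulerWord]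
  | succ d ih =>
    intro a l hl
    obtain ⟨x, l, rfl⟩ := List.exists_cons_of_length_eq_add_one hl
    simp [ones_succ, eulerWord, ih _ _ (by simpa using hl)]

/-- Signs are ratios of consecutive poles. With p = b∏A the pole before the insertion, the
consecutive poles p, a, py have ratios pa and pay; the pole py is unchanged, so the signs in B are
too. -/
theorem insertIdx_eulerWord_ones (a y : ℤˣ) (B : List ℤˣ) (n : ℕ) (A : List ℤˣ) : ∀ b : ℤˣ,
    (eulerWord b (ones (A.length + 1 + n)) (A ++ y :: B)).insertIdx A.length (some a) =
      eulerWord b (ones (A.length + 1 + n + 1)) (A ++ [b * A.prod * a, b * A.prod * a * y] ++ B) := by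
  induction A with
  | nil =>
    intro b
    have h1 : b * (b * a) = a := by rw [← mul_assoc, Int.units_mul_self, one_mul]
    have h2 : a * (b * a * y) = b * y := by
      rw [← mul_assoc, mul_comm b a, ← mul_assoc, Int.units_mul_self, one_mul]
    simp [Nat.add_comm 1 n, ones_succ, eulerWord, h1, h2]
  | cons x A ih =>
    intro b
    rw [List.length_cons, show A.length + 1 + 1 + n = (A.length + 1 + n) + 1 by omega, ones_succ,
      ones_succ]
    simp only [List.cons_append, eulerWord, List.prod_cons, Nat.sub_self, List.replicate_zero,
      List.nil_append, List.insertIdx_succ_cons, ih, ← mul_assoc]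

/-- Insertion at the very end creates only one ratio. This is why the last summand of III lacks an
entry. -/
theorem insertIdx_length_eulerWord_ones (a : ℤˣ) (A : List ℤˣ) : ∀ b : ℤˣ,
    (eulerWord b (ones A.length) A).insertIdx A.length (some a) =
      eulerWord b (ones (A.length + 1)) (A ++ [b * A.prod * a]) := by
  induction A with
  | nil =>
    intro b
    have h1 : b * (b * a) = a := by rw [← mul_assoc, Int.units_mul_self, one_mul]
    simp [ones_succ, eulerWord, h1]
  | cons x A ih =>
    intro b
    rw [List.length_cons, ones_succ, ones_succ]
    simp only [List.cons_append, eulerWord, List.prod_cons, Nat.sub_self, List.replicate_zero,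
      List.nil_append, List.insertIdx_succ_cons, ih, ← mul_assoc]

/-! ### Comparing polynomial expansions -/

theorem polynomial_eq_of_tendsto {ι : Type*} {l : Filter ι} [l.NeBot] {f g : ι → ℝ}
    (hg : Tendsto g l atTop) {P Q : ℝ[X]} (hP : Tendsto (fun x => f x - P.eval (g x)) l (𝓝 0))
    (hQ : Tendsto (fun x => f x - Q.eval (g x)) l (𝓝 0)) : P = Q := by
  refine sub_eq_zero.1 (polynomial_eq_zero_of_tendsto hg ?_)
  have h := hQ.sub hP
  rw [sub_zero] at h
  exact h.congr fun x => by rw [eval_sub]; ring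

theorem tendsto_sum_sub_eval {ι κ : Type*} {l : Filter ι} {S : Finset κ} {f : κ → ι → ℝ}
    {g : ι → ℝ} {P : κ → ℝ[X]}
    (h : ∀ j ∈ S, Tendsto (fun x => f j x - (P j).eval (g x)) l (𝓝 0)) :
    Tendsto (fun x => ∑ j ∈ S, f j x - (∑ j ∈ S, P j).eval (g x)) l (𝓝 0) := by
  have := tendsto_finsetSum S h
  rw [Finset.sum_const_zero] at this
  exact this.congr fun x => by rw [eval_finsetSum, Finset.sum_sub_distrib]

theorem IsStarReg.starReg_eq {s : List ℕ} {μ : List ℤˣ} {P : ℝ[X]} (h : IsStarReg s μ P) :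
    starReg s μ = P :=
  IsStarReg.unique (Classical.epsilon_spec ⟨P, h⟩) h

theorem IsShuffleReg.shuffleReg_eq {s : List ℕ} {μ : List ℤˣ} {P : ℝ[X]}
    (h : IsShuffleReg s μ P) : shuffleReg s μ = P :=
  IsShuffleReg.unique (Classical.epsilon_spec ⟨P, h⟩) h

theorem isStarReg_C_eulerSum {s₁ : ℕ} {s : List ℕ} {μ : List ℤˣ} (h : 2 ≤ s₁)
    (hs : ∀ t ∈ s, 1 ≤ t) (hμ : μ.length = s.length + 1) :
    IsStarReg (s₁ :: s) μ (C (eulerSum (s₁ :: s) μ)) := by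
  simpa [IsStarReg] using (tendsto_truncEulerSum h hs hμ).sub_const (eulerSum (s₁ :: s) μ)

theorem sum_antidiagonal_filter_pos {M : Type*} [AddCommMonoid M] (f : ℕ × ℕ → M) (q : ℕ) :
    ∑ ab ∈ Finset.HasAntidiagonal.antidiagonal (q + 1) with 1 ≤ ab.1 ∧ 1 ≤ ab.2, f ab =
      ∑ i ∈ Finset.range q, f (i + 1, q - i) := by
  refine Finset.sum_nbij' (fun ab => ab.1 - 1) (fun i => (i + 1, q - i)) ?_ ?_ ?_ ?_ ?_
  · rintro ⟨a, b⟩ h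
    simp only [Finset.mem_filter, Finset.HasAntidiagonal.mem_antidiagonal] at h
    simp only [Finset.mem_range]
    omega
  · intro i hi
    have := Finset.mem_range.1 hi
    simp only [Finset.mem_filter, Finset.HasAntidiagonal.mem_antidiagonal]
    omega
  · rintro ⟨a, b⟩ h
    simp only [Finset.mem_filter, Finset.HasAntidiagonal.mem_antidiagonal] at h
    simp only [Prod.mk.injEq]
    omega
  · intro i _
    simp
  · rintro ⟨a, b⟩ h
    simp only [Finset.mem_filter, Finset.HasAntidiagonal.mem_antidiagonal] at h
    congr 2 <;> simp only <;> omega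

theorem tendsto_log_add_eulerMascheroniConstant :
    Tendsto (fun M : ℕ => Real.log M + Real.eulerMascheroniConstant) atTop atTop :=
  tendsto_atTop_add_const_right _ _ (Real.tendsto_log_atTop.comp tendsto_natCast_atTop_atTop)

theorem tendsto_neg_log_nhdsGT_zero : Tendsto (fun ε : ℝ => -Real.log ε) (𝓝[>] 0) atTop :=
  tendsto_neg_atBot_atTop.comp Real.tendsto_log_nhdsGT_zero

/-! ### The two expansions of the product -/

/-- Insertion in front of q gives the only divergent term; every later insertion gives exponents (q,
1_{d+1}) and differs only in where ν₁ stands. Merging hits either q or one of the ones. -/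
theorem truncEulerSum_one_mul_eq (q d : ℕ) (ν : ℕ → ℤˣ) (M : ℕ) :
    truncEulerSum [1] [ν 1] M * truncEulerSum (q :: ones d) (seg ν 2 (d + 2)) M =
      (truncEulerSum (1 :: q :: ones d) (seg ν 1 (d + 2)) M +
        ∑ j ∈ Finset.range (d + 1), truncEulerSum (q :: ones (d + 1))
          (seg ν 2 (j + 2) ++ [ν 1] ++ seg ν (j + 3) (d + 2)) M) +
      (truncEulerSum ((q + 1) :: ones d) ([ν 1 * ν 2] ++ seg ν 3 (d + 2)) M +
        ∑ j ∈ Finset.range d, truncEulerSum (q :: (ones j ++ [2] ++ ones (d - 1 - j)))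
          (seg ν 2 (j + 2) ++ [ν 1 * ν (j + 3)] ++ seg ν (j + 4) (d + 2)) M) := by
  rw [truncEulerSum_singleton_mul 1 (ν 1) _ _ (by simp [length_seg, length_ones]),
    List.length_cons, length_ones, Finset.sum_range_succ' _ (d + 1),
    Finset.sum_range_succ' (fun i => truncEulerSum ((q :: ones d).modify i (1 + ·))
      ((seg ν 2 (d + 2)).modify i (ν 1 * ·)) M) d]
  simp only [List.insertIdx_zero, List.insertIdx_succ_cons, List.modify_succ_cons,
    List.modify_zero_cons]
  have h1 : ν 1 :: seg ν 2 (d + 2) = seg ν 1 (d + 2) := (seg_cons ν (by omega)).symm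
  have h2 : (seg ν 2 (d + 2)).modify 0 (ν 1 * ·) = [ν 1 * ν 2] ++ seg ν 3 (d + 2) := by
    rw [seg_cons ν (show 2 ≤ d + 2 by omega)]
    rfl
  rw [h1, h2, add_comm (∑ j ∈ Finset.range (d + 1), _), add_comm (∑ j ∈ Finset.range d, _),
    add_comm 1 q]
  congr 2
  · refine Finset.sum_congr rfl fun j hj => ?_
    have hj' := Finset.mem_range.1 hj
    rw [insertIdx_ones (by omega), ← insertIdx_seg ν (by omega) (by omega)]
    congr 2
  · refine Finset.sum_congr rfl fun j hj => ?_
    have hj' := Finset.mem_range.1 hj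
    rw [modify_ones (by omega), ← modify_seg ν (i := 2) (j := j + 2) (by omega) (by omega)]
    congr 2

/-- The expansion of the product `ζ(1; ν₁) ζ(q, 1_d; ν₂, …, ν_{d+2})` given by the stuffle
product. -/
theorem eq_sumI_add_sumII {q d : ℕ} (hq : 2 ≤ q) (ν : ℕ → ℤˣ) {P : ℝ[X]}
    (hP : Tendsto (fun M : ℕ => truncEulerSum [1] [ν 1] M *
      truncEulerSum (q :: ones d) (seg ν 2 (d + 2)) M -
      P.eval (Real.log M + Real.eulerMascheroniConstant)) atTop (𝓝 0)) :
    P = sumI q d ν + C (sumII (q + 1) q d ν) := by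
  refine polynomial_eq_of_tendsto tendsto_log_add_eulerMascheroniConstant hP ?_
  have hones : ∀ n, ∀ t ∈ ones n, 1 ≤ t := fun n t => one_le_of_mem_ones
  obtain ⟨Q, hQ, -⟩ := exists_isStarReg_isShuffleReg (μ := seg ν 1 (d + 2)) hq (hones d)
    (by simp [length_seg, length_ones])
  have hA := tendsto_sum_sub_eval (S := Finset.range (d + 1))
    (f := fun j => truncEulerSum (q :: ones (d + 1))
      (seg ν 2 (j + 2) ++ [ν 1] ++ seg ν (j + 3) (d + 2)))
    fun j hj => isStarReg_C_eulerSum hq (hones _) (by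
      have := Finset.mem_range.1 hj
      simp only [List.length_append, length_seg, length_ones, List.length_singleton]
      omega)
  have hB : IsStarReg _ _ _ := isStarReg_C_eulerSum (s₁ := q + 1) (s := ones d)
    (μ := [ν 1 * ν 2] ++ seg ν 3 (d + 2)) (by omega) (hones d)
    (by simp [length_seg, length_ones])
  have hD := tendsto_sum_sub_eval (S := Finset.range d)
    (f := fun j => truncEulerSum (q :: (ones j ++ [2] ++ ones (d - 1 - j)))
      (seg ν 2 (j + 2) ++ [ν 1 * ν (j + 3)] ++ seg ν (j + 4) (d + 2)))
    fun j hj => isStarReg_C_eulerSum hq (fun t ht => by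
      simp only [List.mem_append, List.mem_singleton] at ht
      rcases ht with (ht | rfl) | ht
      · exact hones _ t ht
      · norm_num
      · exact hones _ t ht) (by
      have := Finset.mem_range.1 hj
      simp only [List.length_append, length_seg, length_ones, List.length_singleton]
      omega)
  unfold IsStarReg at hB
  have h := (Tendsto.add hQ hA).add (hB.add hD)
  simp only [add_zero] at h
  refine h.congr fun M => ?_
  rw [truncEulerSum_one_mul_eq, sumI, sumII, hQ.starReg_eq]
  simp only [eval_add, eval_finsetSum, eval_C]
  ring

/-- With i letters dt/t before the inserted pole ν₁, the exponents become (i + 1, q - i, 1_d) and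
the first poles are ν₁ = μ₁ and ν₂ = μ₁μ₂, so the signs are exactly μ. Insertions behind the pole ν₂
only affect the ones. -/
theorem truncEulerIntegral_one_mul_eq {q d : ℕ} (hq : 1 ≤ q) {μ ν : ℕ → ℤˣ} (h1 : ν 1 = μ 1)
    (h2 : ν 2 = μ 1 * μ 2) (h3 : ∀ j, 3 ≤ j → ν j = μ j) {ε : ℝ} (hε : ε ∈ Set.Ioo (0 : ℝ) 1) :
    truncEulerIntegral [1] [ν 1] ε * truncEulerIntegral (q :: ones d) (seg ν 2 (d + 2)) ε =
      ∑ i ∈ Finset.range q,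
        truncEulerIntegral ((i + 1) :: (q - i) :: ones d) (seg μ 1 (d + 2)) ε +
      (∑ j ∈ Finset.range d, truncEulerIntegral (q :: ones (d + 1))
        (seg ν 2 (j + 2) ++ [∏ i ∈ Finset.Icc 1 (j + 2), ν i, ∏ i ∈ Finset.Icc 1 (j + 3), ν i] ++
          seg ν (j + 4) (d + 2)) ε +
      truncEulerIntegral (q :: ones (d + 1))
        (seg ν 2 (d + 2) ++ [∏ i ∈ Finset.Icc 1 (d + 2), ν i]) ε) := by
  simp only [truncEulerIntegral_eq_wordIntegral]
  obtain ⟨k, rfl⟩ := Nat.exists_eq_add_of_le' hq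
  have hone : eulerWord 1 [1] [ν 1] = [some (ν 1)] := by simp [eulerWord]
  set W := eulerWord (ν 2) (ones d) (seg ν 3 (d + 2)) with hW
  have hword : eulerWord 1 ((k + 1) :: ones d) (seg ν 2 (d + 2)) =
      (List.replicate k none ++ [some (ν 2)]) ++ W := by
    rw [seg_cons ν (show 2 ≤ d + 2 by omega)]
    simp [eulerWord, hW]
  have hlen : (eulerWord 1 ((k + 1) :: ones d) (seg ν 2 (d + 2))).length + 1 =
      (k + 1) + (d + 1) := by
    rw [hword, List.length_append, hW, length_eulerWord_ones d _ _ (by simp [length_seg])]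
    simp
    omega
  have hinsert : ∀ j, ((List.replicate k none ++ [some (ν 2)]) ++ W).insertIdx (k + 1 + j)
      (some (ν 1)) = (List.replicate k none ++ [some (ν 2)]) ++ W.insertIdx j (some (ν 1)) := by
    intro j
    have := insertIdx_append_length_add (List.replicate k none ++ [some (ν 2)]) W (some (ν 1)) j
    rwa [List.length_append, List.length_replicate, List.length_singleton] at this
  -- Rearranged into the shape b∏A·a produced by inserting a pole into a word of ones.
  have hprod : ∀ j, ∏ i ∈ Finset.Icc 1 (j + 2), ν i = ν 2 * (seg ν 3 (j + 2)).prod * ν 1 := by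
    intro j
    rw [← prod_seg, seg_cons ν (by omega), seg_cons ν (by omega), List.prod_cons, List.prod_cons,
      mul_comm]
  have hcons : ∀ l : List ℤˣ, eulerWord 1 ((k + 1) :: ones (d + 1)) (ν 2 :: l) =
      (List.replicate k none ++ [some (ν 2)]) ++ eulerWord (ν 2) (ones (d + 1)) l := by
    intro l
    simp [eulerWord]
  -- The insertion positions split into the q = k + 1 places up to the pole ν₂, the d places before
  -- a later pole, and the end of the word.
  rw [hone, wordIntegral_singleton_mul _ (endsInPole_eulerWord _ _ _) (by linarith [hε.2])
    (by linarith [hε.1]), hlen, Finset.sum_range_add _ (k + 1), Finset.sum_range_succ _ d, hword]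
  congr 1
  · refine Finset.sum_congr rfl fun i hi => ?_
    have hi' := Finset.mem_range.1 hi
    congr 1
    have hrep : List.replicate k (none : Option ℤˣ) =
        List.replicate i none ++ List.replicate (k - i) none := by
      rw [← List.replicate_add]
      congr 1
      omega
    have := insertIdx_append_length (List.replicate i (none : Option ℤˣ))
      (List.replicate (k - i) none ++ [some (ν 2)] ++ W) (some (ν 1))
    rw [List.length_replicate] at this
    rw [hrep, List.append_assoc, List.append_assoc, ← List.append_assoc (List.replicate (k - i) _),
      this, seg_cons μ (show 1 ≤ d + 2 by omega), seg_cons μ (show 1 + 1 ≤ d + 2 by omega)]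
    simp only [eulerWord, one_mul, Nat.add_sub_cancel, h1, hW, h2,
      seg_congr (k := d + 2) h3, show k + 1 - i - 1 = k - i by omega]
    simp
  · congr 1
    · refine Finset.sum_congr rfl fun j hj => ?_
      have hj' := Finset.mem_range.1 hj
      congr 1
      rw [hinsert, seg_cons ν (show 2 ≤ j + 2 by omega), List.cons_append, List.cons_append, hcons,
        hprod, hprod (j + 1)]
      congr 1
      have hA : (seg ν 3 (j + 2)).length = j := by simp [length_seg]
      have h := insertIdx_eulerWord_ones (ν 1) (ν (j + 3)) (seg ν (j + 4) (d + 2)) (d - 1 - j)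
        (seg ν 3 (j + 2)) (ν 2)
      rw [hA, show j + 1 + (d - 1 - j) = d by omega,
        ← seg_cons ν (show j + 3 ≤ d + 2 by omega), seg_append ν (by omega) (by omega)] at h
      rw [hW, h, ← seg_append ν (k := j + 2) (show 3 ≤ j + 2 + 1 by omega)
        (show j + 2 ≤ j + 1 + 2 by omega),
        seg_cons ν (show j + 2 + 1 ≤ j + 1 + 2 by omega),
        seg_eq_nil ν (show j + 1 + 2 < j + 2 + 1 + 1 by omega), List.prod_append,
        List.prod_singleton]
      congr 5
      ac_rfl
    · rw [hinsert, seg_cons ν (show 2 ≤ d + 2 by omega), List.cons_append, hcons, hprod]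
      have hA : (seg ν 3 (d + 2)).length = d := by simp [length_seg]
      have h := insertIdx_length_eulerWord_ones (ν 1) (seg ν 3 (d + 2)) (ν 2)
      rw [hA] at h
      rw [hW, h]

/-- The expansion of the product `ζ(1; ν₁) ζ(q, 1_d; ν₂, …, ν_{d+2})` given by the shuffle
product. -/
theorem sum_shuffleReg_eq_sub_sumIII {q d : ℕ} (hq : 2 ≤ q) {μ ν : ℕ → ℤˣ} (h1 : ν 1 = μ 1)
    (h2 : ν 2 = μ 1 * μ 2) (h3 : ∀ j, 3 ≤ j → ν j = μ j) {P : ℝ[X]}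
    (hreg : ∀ i < q, IsShuffleReg ((i + 1) :: (q - i) :: ones d) (seg μ 1 (d + 2))
      (shuffleReg ((i + 1) :: (q - i) :: ones d) (seg μ 1 (d + 2))))
    (hP : Tendsto (fun ε : ℝ => truncEulerIntegral [1] [ν 1] ε *
      truncEulerIntegral (q :: ones d) (seg ν 2 (d + 2)) ε - P.eval (-Real.log ε))
      (𝓝[>] 0) (𝓝 0)) :
    ∑ i ∈ Finset.range q, shuffleReg ((i + 1) :: (q - i) :: ones d) (seg μ 1 (d + 2)) =
      P - C (sumIII q d ν) := by
  rw [eq_sub_iff_add_eq]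
  refine (polynomial_eq_of_tendsto tendsto_neg_log_nhdsGT_zero hP ?_).symm
  have hones : ∀ n, ∀ t ∈ ones n, 1 ≤ t := fun n t => one_le_of_mem_ones
  have hA := tendsto_sum_sub_eval (S := Finset.range q)
    fun i hi => hreg i (Finset.mem_range.1 hi)
  have hB := tendsto_sum_sub_eval (S := Finset.range d)
    (f := fun j => truncEulerIntegral (q :: ones (d + 1))
      (seg ν 2 (j + 2) ++ [∏ i ∈ Finset.Icc 1 (j + 2), ν i, ∏ i ∈ Finset.Icc 1 (j + 3), ν i] ++
        seg ν (j + 4) (d + 2)))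
    fun j hj => isShuffleReg_C_eulerSum hq (hones _) (by
      have := Finset.mem_range.1 hj
      simp only [List.length_append, length_seg, length_ones, List.length_cons, List.length_nil]
      omega)
  have hD : IsShuffleReg _ _ _ := isShuffleReg_C_eulerSum (s₁ := q) (s := ones (d + 1))
    (μ := seg ν 2 (d + 2) ++ [∏ i ∈ Finset.Icc 1 (d + 2), ν i]) hq (hones _)
    (by simp [length_seg, length_ones])
  unfold IsShuffleReg at hD
  have h := hA.add (hB.add hD)
  simp only [add_zero] at h
  refine h.congr' ?_
  filter_upwards [eventually_mem_Ioo_nhdsGT_zero] with ε hε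
  rw [truncEulerIntegral_one_mul_eq (by omega) h1 h2 h3 hε, sumIII]
  simp only [eval_add, eval_finsetSum, eval_C]
  ring

/-! ### The restricted sum formula -/

theorem antidiagonal_filter_pos_eq_insert (u : ℕ) :
    ((Finset.HasAntidiagonal.antidiagonal (u + 2)).filter fun ab => 1 ≤ ab.1 ∧ 1 ≤ ab.2) =
      insert (1, u + 1)
        ((Finset.HasAntidiagonal.antidiagonal (u + 2)).filter fun ab => 2 ≤ ab.1 ∧ 1 ≤ ab.2) := by
  ext ⟨a, b⟩
  simp only [Finset.mem_filter, Finset.HasAntidiagonal.mem_antidiagonal, Finset.mem_insert,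
    Prod.mk.injEq]
  omega

/-- The signs are `μ 1, …, μ (d + 2)`; no other value of `μ` matters. -/
theorem theorem3p1 (u q d : ℕ) (hu : 3 ≤ u) (hq : q = u - 1) (μ : ℕ → ℤˣ) :
    -- all Euler sums `ζ(s; ξ)` with `s₁ ≥ 2` converge
    (∀ (s₁ : ℕ) (s : List ℕ) (ξ : List ℤˣ), 2 ≤ s₁ → (∀ t ∈ s, 1 ≤ t) → ξ.length = s.length + 1 →
      Tendsto (truncEulerSum (s₁ :: s) ξ) atTop (𝓝 (eulerSum (s₁ :: s) ξ))) ∧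
    -- the regularized values in the formula exist
    (∀ a b : ℕ, 1 ≤ a → 1 ≤ b → a + b = u →
      IsShuffleReg (a :: b :: ones d) (seg μ 1 (d + 2))
        (shuffleReg (a :: b :: ones d) (seg μ 1 (d + 2)))) ∧
    IsStarReg (1 :: q :: ones d) (seg (nuSigns μ) 1 (d + 2))
      (starReg (1 :: q :: ones d) (seg (nuSigns μ) 1 (d + 2))) ∧
    -- the restricted sum formula, an identity in `ℝ[T]`
    (∑ ab ∈ Finset.HasAntidiagonal.antidiagonal u with 1 ≤ ab.1 ∧ 1 ≤ ab.2,
        shuffleReg (ab.1 :: ab.2 :: ones d) (seg μ 1 (d + 2)) =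
      sumI q d (nuSigns μ) + C (sumII u q d (nuSigns μ)) - C (sumIII q d (nuSigns μ))) ∧
    -- the case `μ₁ = 1`, with the sum restricted to `a ≥ 2`
    (μ 1 = 1 →
      ∑ ab ∈ Finset.HasAntidiagonal.antidiagonal u with 2 ≤ ab.1 ∧ 1 ≤ ab.2,
          eulerSum (ab.1 :: ab.2 :: ones d) ([1] ++ seg μ 2 (d + 2)) =
        eulerSum (u :: ones d) (seg μ 2 (d + 2)) +
        ∑ j ∈ Finset.range (d + 1),
          eulerSum (q :: ones (d + 1)) (seg μ 2 (j + 2) ++ [μ 1] ++ seg μ (j + 3) (d + 2)) +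
        ∑ j ∈ Finset.range d,
          eulerSum (q :: (ones j ++ [2] ++ ones (d - 1 - j))) (seg μ 2 (d + 2)) -
        (∑ j ∈ Finset.range d,
            eulerSum (q :: ones (d + 1))
              (seg μ 2 (j + 2) ++
                [∏ i ∈ Finset.Icc 2 (j + 2), μ i, ∏ i ∈ Finset.Icc 2 (j + 3), μ i] ++
                seg μ (j + 4) (d + 2)) +
          eulerSum (q :: ones (d + 1))
            (seg μ 2 (d + 2) ++ [∏ i ∈ Finset.Icc 2 (d + 2), μ i]))) := by
  obtain rfl : u = q + 1 := by omega
  have hq2 : 2 ≤ q := by omega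
  have hones : ∀ n, ∀ t ∈ ones n, 1 ≤ t := fun n t => one_le_of_mem_ones
  have hlen : (seg μ 1 (d + 2)).length = (ones d).length + 2 := by simp [length_seg, length_ones]
  have hreg1 : ∃ P, IsShuffleReg (1 :: q :: ones d) (seg μ 1 (d + 2)) P := by
    obtain ⟨P, -, hP⟩ := exists_isStarReg_isShuffleReg hq2 (hones d) hlen
    exact ⟨P, hP⟩
  have hreg2 : ∀ a b : ℕ, 2 ≤ a → 1 ≤ b → IsShuffleReg (a :: b :: ones d) (seg μ 1 (d + 2))
      (C (eulerSum (a :: b :: ones d) (seg μ 1 (d + 2)))) := fun a b ha hb =>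
    isShuffleReg_C_eulerSum ha (by simpa [hb] using hones d) (by simpa using hlen)
  have hreg : ∀ a b : ℕ, 1 ≤ a → 1 ≤ b → a + b = q + 1 →
      IsShuffleReg (a :: b :: ones d) (seg μ 1 (d + 2))
        (shuffleReg (a :: b :: ones d) (seg μ 1 (d + 2))) := by
    intro a b ha hb hab
    rcases ha.eq_or_lt with rfl | ha
    -- The only divergent term is a = 1, where b = q ≥ 2 leaves a single leading 1.
    · obtain rfl : b = q := by omega
      exact Classical.epsilon_spec hreg1
    · exact Classical.epsilon_spec ⟨_, hreg2 a b ha hb⟩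
  obtain ⟨Q, hQ, -⟩ := exists_isStarReg_isShuffleReg (μ := seg (nuSigns μ) 1 (d + 2)) hq2 (hones d)
    (by simp [length_seg, length_ones])
  have hmain : ∑ ab ∈ Finset.HasAntidiagonal.antidiagonal (q + 1) with 1 ≤ ab.1 ∧ 1 ≤ ab.2,
        shuffleReg (ab.1 :: ab.2 :: ones d) (seg μ 1 (d + 2)) =
      sumI q d (nuSigns μ) + C (sumII (q + 1) q d (nuSigns μ)) - C (sumIII q d (nuSigns μ)) := by
    obtain ⟨P, hP1, hP2⟩ := exists_reg_one_mul (μ := seg (nuSigns μ) 2 (d + 2)) (nuSigns μ 1) hq2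
      (hones d) (by simp [length_seg, length_ones])
    rw [sum_antidiagonal_filter_pos, ← eq_sumI_add_sumII hq2 _ hP1]
    refine sum_shuffleReg_eq_sub_sumIII hq2 (if_neg (by norm_num)) (if_pos rfl)
      (fun j hj => if_neg (by omega)) (fun i hi => ?_) hP2
    exact hreg _ _ (by omega) (by omega) (by omega)
  refine ⟨fun s₁ s ξ => tendsto_truncEulerSum, hreg, Classical.epsilon_spec ⟨Q, hQ⟩, hmain,
    fun hμ => ?_⟩
  have hν : nuSigns μ = μ := by
    funext j
    simp only [nuSigns, hμ, one_mul]
    split_ifs with hj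
    · rw [hj]
    · rfl
  have hseg : [1] ++ seg μ 2 (d + 2) = seg μ 1 (d + 2) := by
    rw [seg_cons μ (show 1 ≤ d + 2 by omega), hμ]
    rfl
  -- When μ₁ = 1 the term a = 1 carries the same signs as the regularized term in I, so the two
  -- cancel and only convergent sums remain.
  have hstar : shuffleReg (1 :: q :: ones d) (seg μ 1 (d + 2)) =
      starReg (1 :: q :: ones d) (seg μ 1 (d + 2)) := by
    obtain ⟨P, hP1, hP2⟩ := exists_isStarReg_isShuffleReg hq2 (hones d) hlen
    rw [hP1.starReg_eq, hP2.shuffleReg_eq]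
  have hprod : ∀ j, ∏ i ∈ Finset.Icc 1 (j + 1), μ i = ∏ i ∈ Finset.Icc 2 (j + 1), μ i := by
    intro j
    rw [← prod_seg, ← prod_seg, seg_cons μ (by omega), List.prod_cons, hμ, one_mul]
  have hII : ∀ j ∈ Finset.range d, seg μ 2 (j + 2) ++ [μ 1 * μ (j + 3)] ++ seg μ (j + 4) (d + 2) =
      seg μ 2 (d + 2) := by
    intro j hj
    have hj' := Finset.mem_range.1 hj
    rw [hμ, one_mul, List.append_assoc, List.singleton_append,
      ← seg_cons μ (show j + 3 ≤ d + 2 by omega), seg_append μ (by omega) (by omega)]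
  have hsum : ∑ ab ∈ Finset.HasAntidiagonal.antidiagonal (q + 1) with 2 ≤ ab.1 ∧ 1 ≤ ab.2,
        shuffleReg (ab.1 :: ab.2 :: ones d) (seg μ 1 (d + 2)) =
      C (∑ ab ∈ Finset.HasAntidiagonal.antidiagonal (q + 1) with 2 ≤ ab.1 ∧ 1 ≤ ab.2,
        eulerSum (ab.1 :: ab.2 :: ones d) (seg μ 1 (d + 2))) := by
    rw [map_sum]
    refine Finset.sum_congr rfl fun ab hab => ?_
    obtain ⟨-, ha, hb⟩ := Finset.mem_filter.1 hab
    exact (hreg2 _ _ ha hb).shuffleReg_eq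
  -- Makes the weight literally k + 2, the form in which the pair (1, q) is split off.
  obtain ⟨k, rfl⟩ := Nat.exists_eq_add_of_le' (show 1 ≤ q by omega)
  have hsumII : sumII (k + 1 + 1) (k + 1) d μ = eulerSum ((k + 1 + 1) :: ones d) (seg μ 2 (d + 2)) +
      ∑ j ∈ Finset.range d,
        eulerSum ((k + 1) :: (ones j ++ [2] ++ ones (d - 1 - j))) (seg μ 2 (d + 2)) := by
    rw [sumII, hμ, one_mul, List.singleton_append, ← seg_cons μ (show 2 ≤ d + 2 by omega), ← hμ]
    exact congrArg _ (Finset.sum_congr rfl fun j hj => by rw [hII j hj])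
  rw [hν, antidiagonal_filter_pos_eq_insert, Finset.sum_insert (by simp), hstar, hsum, sumI,
    hsumII, sumIII, ← map_sum] at hmain
  simp only [hprod] at hmain
  rw [hseg]
  apply C_injective (R := ℝ)
  simp only [C_add, C_sub] at hmain ⊢
  linear_combination hmain
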